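/- Let $\mathbb H$ be a separable complex Hilbert space with a fixed complete orthonormal system $\{e_j\}$ (the "real" basis), let $\overline{x}=\sum_j\overline{\langle x,e_j\rangle}e_j$, call $x$ real if $\overline x=x$, and let $[x\otimes y](z)=\langle z,y\rangle x$. For a bounded operator $A$ on $\mathbb H$ put $\|A\|_{\rm tr}=\sum_j\langle (A^*A)^{1/2}e_j,e_j\rangle$ and $\|A\|_{\rm HS}=(\sum_j\|Ae_j\|^2)^{1/2}$, and let $\langle A,B\rangle_{\rm HS}={\rm trace}(A^*B)$. Let $X=\{X(t),\,t\in\mathbb R^d\}$ be a zero-mean, second-order stationary, real $\mathbb H$-valued process: $\mathbb E\|X(t)\|^2<\infty$, and $\mathbb E[X(t)\otimes X(s)]$ and $\mathbb E[X(t)\otimes\overline{X(s)}]$ depend only on $t-s$. Write $C(h)=\mathbb E[X(h)\otimes X(0)]$. Assume the following. (C) $\int_{\mathbb R^d}\|C(h)\|_{\rm tr}\,dh<\infty$, and for some $0<\gamma\le 1$, $M_0<\infty$ and $\delta_0>0$, $$\int_{\mathbb R^d}\sup_{y:\|x-y\|\le\delta}\|C(y)-C(x)\|_{\rm tr}\,dx\le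 M_0\,\delta^\gamma\qquad\text{for all }0<\delta\le\delta_0 .$$ (K) $K:\mathbb R^d\to[0,\infty)$ is Lipschitz continuous, $S_K=\{u:K(u)>0\}$ is bounded, $\sup_u K(u)=K(0)=1$, and $K$ is differentiable with bounded gradient in some ball around $0$. (S) For each $n$ the process is observed at distinct points $t_{n,1},\dots,t_{n,n}\in\mathbb R^d$. Let $\mathbb T_n$ be the set of these points, $T_n$ its closed convex hull, $|\cdot|$ Lebesgue measure, $V(t_{n,i})=\{x\in T_n:\|x-t_{n,i}\|\le\|x-t_{n,j}\|\ \forall j\}$ the Voronoi cells, and $\delta_n=\max_i\sup_{x\in V(t_{n,i})}\|x-t_{n,i}\|$. Then $\delta_n\to0$, $|T_n|\to\infty$, and $T_n/|T_n|^{1/d}\to T$ in the Hausdorff metric for some bounded convex set $T$ with non-empty interior. (V) $\mathbb E\|X(t)\|^4<\infty$ for all $t$. The fourth-order cumulant $${\rm cum}(Y_1,Y_2,Y_3,Y_4)=\mathbb E\langle Y_1\otimes Y_2,Y_3\otimes Y_4\rangle_{\rm HS}-\langle\mathbb E(Y_1\otimes Y_2),\mathbb E(Y_3\otimes Y_4)\rangle_{\rm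 HS}-\mathbb E\langle Y_1,Y_3\rangle\,\mathbb E\langle Y_4,Y_2\rangle-\langle\mathbb E(Y_1\otimes\overline{Y_4}),\mathbb E(Y_3\otimes\overline{Y_2})\rangle_{\rm HS}$$ satisfies ${\rm cum}(X(t+\tau),X(s+\tau),X(w+\tau),X(v+\tau))={\rm cum}(X(t),X(s),X(w),X(v))$ for all $t,s,w,v,\tau$, and for some $\delta>0$ $$\sup_{w}\int\!\!\int\sup_{\|\lambda_1\|,\|\lambda_2\|,\|\lambda_3\|<\delta}|{\rm cum}(X(\lambda_1+u),X(\lambda_2+v),X(\lambda_3+w),X(0))|\,dv\,du<\infty .$$ Let $\Delta_n>0$ satisfy $\Delta_n\to\infty$, $\Delta_n^d/|T_n|\to0$, and $\Delta_n S_K\subset T_n-T_n$ for all sufficiently large $n$. Let $f(\theta)=(2\pi)^{-d}\int e^{\mathbf i h^\top\theta}C(h)\,dh$ be the spectral density and $$\hat f_n(\theta)=\frac1{(2\pi)^d}\sum_{t,s\in\mathbb T_n}e^{\mathbf i(t-s)^\top\theta}\,\frac{X(t)\otimes X(s)}{|T_n\cap(T_n-(t-s))|}\,K\Big(\frac{t-s}{\Delta_n}\Big)|V(t)|\,|V(s)|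 ,$$ and put $$B_1(\Delta_n;\theta)=\Big\|\int_{\Delta_nS_K}e^{\mathbf i h^\top\theta}C(h)\Big(1-K\Big(\frac h{\Delta_n}\Big)\Big)dh\Big\|_{\rm HS},\qquad B_2(\Delta_n;\theta)=\Big\|\int_{\mathbb R^d\setminus\Delta_nS_K}e^{\mathbf i h^\top\theta}C(h)\,dh\Big\|_{\rm HS}.$$ Then for every bounded $\Theta\subset\mathbb R^d$, $$\big(\mathbb E\|\hat f_n(\theta)-f(\theta)\|_{\rm HS}^2\big)^{1/2}=\mathcal O\Big(\delta_n^\gamma+B_1(\Delta_n;\theta)+B_2(\Delta_n;\theta)+\sqrt{\Delta_n^d/|T_n|}\Big)\qquad(n\to\infty)$$ uniformly in $\theta\in\Theta$: there are $M<\infty$ and $n_0$ such that for all $n\ge n_0$ and all $\theta\in\Theta$ the left-hand side is at most $M$ times the expression in parentheses. In particular, the same bound holds with the supremum over $\theta\in\Theta$ of the left-hand side and of $B_1,B_2$. -/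

import Mathlib

open Filter MeasureTheory Topology
open scoped ENNReal NNReal Pointwise

noncomputable section

namespace SpectralDensity

/-! ### Operators on a complex Hilbert space with a designated (real) orthonormal basis -/

section Operators

variable {ι H : Type*} [NormedAddCommGroup H] [InnerProductSpace ℂ H]

/-- The cross product `x ⊗ y`, i.e. the operator `z ↦ ⟨z, y⟩ x` (linear in `z`). -/
def outer (x y : H) : H →L[ℂ] H := InnerProductSpace.rankOne ℂ x y

/-- Complex conjugation with respect to the basis `b`: coordinates are conjugated. -/
def conj (b : HilbertBasis ι ℂ H) (x : H) : H := b.repr.symm (star (b.repr x))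

/-- The trace norm `∑ⱼ ⟨(A⋆A)^{1/2} eⱼ, eⱼ⟩`, with values in `[0, ∞]`. -/
def traceNorm [CompleteSpace H] (b : HilbertBasis ι ℂ H) (A : H →L[ℂ] H) : ℝ≥0∞ :=
  ∑' j, ENNReal.ofReal (inner ℂ (CFC.abs A (b j)) (b j)).re

/-- The Hilbert-Schmidt norm `(∑ⱼ ‖A eⱼ‖²)^{1/2}`, with values in `[0, ∞]`. -/
def hsNorm (b : HilbertBasis ι ℂ H) (A : H →L[ℂ] H) : ℝ≥0∞ :=
  (∑' j, ‖A (b j)‖ₑ ^ 2) ^ (1 / 2 : ℝ)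

/-- The Hilbert-Schmidt inner product `trace (A⋆ B) = ∑ⱼ ⟨A eⱼ, B eⱼ⟩`
(antilinear in the first argument, as is Mathlib's inner product). -/
def hsInner (b : HilbertBasis ι ℂ H) (A B : H →L[ℂ] H) : ℂ :=
  ∑' j, inner ℂ (A (b j)) (B (b j))

end Operators

/-! ### Second-order structure of Hilbert-space valued processes -/

section StochProc

variable {d : ℕ} {ι H Ω : Type*} [NormedAddCommGroup H] [InnerProductSpace ℂ H]
  [CompleteSpace H] [MeasurableSpace Ω]

/-- The cross-covariance operator `𝔼[Y ⊗ Z]` of zero-mean random elements (Bochner integral). -/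
def covOp (P : Measure Ω) (Y Z : Ω → H) : H →L[ℂ] H := ∫ ω, outer (Y ω) (Z ω) ∂P

/-- A zero-mean second-order process `X` on `ℝᵈ` whose covariance operator `𝔼[X(t) ⊗ X(s)]` and
pseudo-covariance operator `𝔼[X(t) ⊗ conj X(s)]` depend only on the lag `t - s`. -/
structure IsSecondOrderStationary (b : HilbertBasis ι ℂ H) (P : Measure Ω)
    (X : EuclideanSpace ℝ (Fin d) → Ω → H) : Prop where
  memLp : ∀ t, MemLp (X t) 2 P
  mean_zero : ∀ t, ∫ ω, X t ω ∂P = 0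
  cov_shift : ∀ t s τ, covOp P (X (t + τ)) (X (s + τ)) = covOp P (X t) (X s)
  pseudoCov_shift : ∀ t s τ,
    covOp P (X (t + τ)) (fun ω => conj b (X (s + τ) ω))
      = covOp P (X t) (fun ω => conj b (X s ω))

/-- The process takes (almost surely) values in the real part of `H`. -/
def IsRealProcess (b : HilbertBasis ι ℂ H) (P : Measure Ω)
    (X : EuclideanSpace ℝ (Fin d) → Ω → H) : Prop :=
  ∀ t, ∀ᵐ ω ∂P, conj b (X t ω) = X t ω

/-- The stationary covariance operator `C(h) = 𝔼[X(h) ⊗ X(0)]`. -/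
def stationaryCov (P : Measure Ω) (X : EuclideanSpace ℝ (Fin d) → Ω → H)
    (h : EuclideanSpace ℝ (Fin d)) : H →L[ℂ] H :=
  covOp P (X h) (X 0)

/-- The fourth-order cumulant of zero-mean random elements of `H`. -/
def cum (b : HilbertBasis ι ℂ H) (P : Measure Ω) (Y₁ Y₂ Y₃ Y₄ : Ω → H) : ℂ :=
  (∫ ω, hsInner b (outer (Y₁ ω) (Y₂ ω)) (outer (Y₃ ω) (Y₄ ω)) ∂P)
    - hsInner b (covOp P Y₁ Y₂) (covOp P Y₃ Y₄)
    - (∫ ω, inner ℂ (Y₁ ω) (Y₃ ω) ∂P) * (∫ ω, inner ℂ (Y₄ ω) (Y₂ ω) ∂P)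
    - hsInner b (covOp P Y₁ (fun ω => conj b (Y₄ ω))) (covOp P Y₃ (fun ω => conj b (Y₂ ω)))

/-- The character `e^{i hᵀθ}`. -/
def character (h θ : EuclideanSpace ℝ (Fin d)) : ℂ :=
  Complex.exp (Complex.I * ((inner ℝ h θ : ℝ) : ℂ))

/-- The spectral density `f(θ) = (2π)⁻ᵈ ∫ e^{i hᵀθ} C(h) dh` (Bochner integral). -/
def spectralDensity (P : Measure Ω) (X : EuclideanSpace ℝ (Fin d) → Ω → H)
    (θ : EuclideanSpace ℝ (Fin d)) : H →L[ℂ] H :=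
  (((2 * Real.pi) ^ d : ℝ)⁻¹ : ℂ) • ∫ h, character h θ • stationaryCov P X h

end StochProc

/-! ### The sampling design -/

section Design

variable {d n : ℕ}

/-- The sampling region: the closed convex hull of the observed locations. -/
def region (t : Fin n → EuclideanSpace ℝ (Fin d)) : Set (EuclideanSpace ℝ (Fin d)) :=
  closure (convexHull ℝ (Set.range t))

/-- The Voronoi cell of the `i`-th location, within the sampling region. -/
def cell (t : Fin n → EuclideanSpace ℝ (Fin d)) (i : Fin n) : Set (EuclideanSpace ℝ (Fin d)) :=
  {x | x ∈ region t ∧ ∀ j, ‖x - t i‖ ≤ ‖x - t j‖}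

/-- The diameter `max_i sup_{x ∈ V(tᵢ)} ‖x - tᵢ‖` of the Voronoi tessellation. -/
def tessDiam (t : Fin n → EuclideanSpace ℝ (Fin d)) : ℝ :=
  ⨆ i, ⨆ x : cell t i, ‖(x : EuclideanSpace ℝ (Fin d)) - t i‖

/-- The Lebesgue measure `|T|` of the sampling region. -/
def regionVol (t : Fin n → EuclideanSpace ℝ (Fin d)) : ℝ := volume.real (region t)

/-- The volume `|T ∩ (T - h)|`. -/
def overlapVol (t : Fin n → EuclideanSpace ℝ (Fin d)) (h : EuclideanSpace ℝ (Fin d)) : ℝ :=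
  volume.real (region t ∩ (fun x => x - h) '' region t)

/-- The set `S_K` on which the kernel is positive. -/
def kernelSupp (K : EuclideanSpace ℝ (Fin d) → ℝ) : Set (EuclideanSpace ℝ (Fin d)) :=
  {u | 0 < K u}

end Design

/-! ### Estimator and bias terms -/

section Estimator

variable {d n : ℕ} {ι H Ω : Type*} [NormedAddCommGroup H] [InnerProductSpace ℂ H]
  [CompleteSpace H] [MeasurableSpace Ω]

/-- The estimator `f̂(θ)` computed from the observations of `X` at the locations `tᵢ`,
with kernel `K` and bandwidth `Δ`. -/
def estimator (X : EuclideanSpace ℝ (Fin d) → Ω → H) (K : EuclideanSpace ℝ (Fin d) → ℝ)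
    (t : Fin n → EuclideanSpace ℝ (Fin d)) (Δ : ℝ) (θ : EuclideanSpace ℝ (Fin d)) (ω : Ω) :
    H →L[ℂ] H :=
  (((2 * Real.pi) ^ d : ℝ)⁻¹ : ℂ) • ∑ i, ∑ j,
    (character (t i - t j) θ *
      ((K (Δ⁻¹ • (t i - t j)) * volume.real (cell t i) * volume.real (cell t j)
        / overlapVol t (t i - t j) : ℝ) : ℂ)) • outer (X (t i) ω) (X (t j) ω)

/-- The root mean square error `(𝔼 ‖f̂(θ) - f(θ)‖²_HS)^{1/2}`. -/
def rootMSE (b : HilbertBasis ι ℂ H) (P : Measure Ω) (X : EuclideanSpace ℝ (Fin d) → Ω → H)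
    (K : EuclideanSpace ℝ (Fin d) → ℝ) (t : Fin n → EuclideanSpace ℝ (Fin d)) (Δ : ℝ)
    (θ : EuclideanSpace ℝ (Fin d)) : ℝ≥0∞ :=
  (∫⁻ ω, hsNorm b (estimator X K t Δ θ ω - spectralDensity P X θ) ^ 2 ∂P) ^ (1 / 2 : ℝ)

/-- `B₁(Δ; θ) = ‖∫_{Δ S_K} e^{i hᵀθ} C(h) (1 - K(h/Δ)) dh‖_HS`. -/
def biasKernel (b : HilbertBasis ι ℂ H) (P : Measure Ω) (X : EuclideanSpace ℝ (Fin d) → Ω → H)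
    (K : EuclideanSpace ℝ (Fin d) → ℝ) (Δ : ℝ) (θ : EuclideanSpace ℝ (Fin d)) : ℝ≥0∞ :=
  hsNorm b (∫ h in Δ • kernelSupp K,
    (character h θ * ((1 - K (Δ⁻¹ • h) : ℝ) : ℂ)) • stationaryCov P X h)

/-- `B₂(Δ; θ) = ‖∫_{h ∉ Δ S_K} e^{i hᵀθ} C(h) dh‖_HS`. -/
def biasTail (b : HilbertBasis ι ℂ H) (P : Measure Ω) (X : EuclideanSpace ℝ (Fin d) → Ω → H)
    (K : EuclideanSpace ℝ (Fin d) → ℝ) (Δ : ℝ) (θ : EuclideanSpace ℝ (Fin d)) : ℝ≥0∞ :=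
  hsNorm b (∫ h in (Δ • kernelSupp K)ᶜ, character h θ • stationaryCov P X h)

end Estimator

/-! ### Assumptions -/

section Assumptions

variable {d : ℕ} {ι H Ω : Type*} [NormedAddCommGroup H] [InnerProductSpace ℂ H]
  [CompleteSpace H] [MeasurableSpace Ω]

/-- The covariance is integrable in trace norm and `L¹`-`γ`-Hölder (at all small scales `δ`). -/
structure CovarianceAssumption (b : HilbertBasis ι ℂ H) (P : Measure Ω)
    (X : EuclideanSpace ℝ (Fin d) → Ω → H) (γ : ℝ) : Prop where
  aestronglyMeasurable : AEStronglyMeasurable (stationaryCov P X) volume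
  integrable : (∫⁻ h, traceNorm b (stationaryCov P X h)) < ∞
  gamma_pos : 0 < γ
  gamma_le_one : γ ≤ 1
  holder : ∃ M : ℝ≥0, ∃ δ₀ > (0 : ℝ), ∀ δ : ℝ, 0 < δ → δ ≤ δ₀ →
    (∫⁻ x, ⨆ y ∈ Metric.closedBall x δ,
      traceNorm b (stationaryCov P X y - stationaryCov P X x)) ≤ M * ENNReal.ofReal (δ ^ γ)

/-- The kernel is nonnegative, Lipschitz continuous, of bounded support, with maximum `K(0) = 1`,
and differentiable with bounded gradient near `0`. -/
structure KernelAssumption (K : EuclideanSpace ℝ (Fin d) → ℝ) : Prop where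
  nonneg : ∀ u, 0 ≤ K u
  lipschitz : ∃ L : ℝ≥0, LipschitzWith L K
  isBounded_supp : Bornology.IsBounded (kernelSupp K)
  at_zero : K 0 = 1
  le_one : ∀ u, K u ≤ 1
  differentiable_near : ∃ ε > (0 : ℝ), (∀ u ∈ Metric.ball 0 ε, DifferentiableAt ℝ K u) ∧
    ∃ M : ℝ, ∀ u ∈ Metric.ball 0 ε, ‖gradient K u‖ ≤ M

/-- Mixed-domain asymptotics for the designs `(t n i)_{i < n}`: distinct locations, tessellation
diameter tending to zero, volume of the sampling region tending to infinity, and convergence in the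
Hausdorff distance of the rescaled region to a bounded convex set with non-empty interior. -/
structure SamplingAssumption (t : (n : ℕ) → Fin n → EuclideanSpace ℝ (Fin d)) : Prop where
  distinct : ∀ n, Function.Injective (t n)
  diam_tendsto : Tendsto (fun n => tessDiam (t n)) atTop (𝓝 0)
  vol_tendsto : Tendsto (fun n => regionVol (t n)) atTop atTop
  shape : ∃ T : Set (EuclideanSpace ℝ (Fin d)), Bornology.IsBounded T ∧ Convex ℝ T ∧
    (interior T).Nonempty ∧
    Tendsto (fun n => Metric.hausdorffEDist
      ((regionVol (t n) ^ (1 / (d : ℝ)))⁻¹ • region (t n)) T) atTop (𝓝 0)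

/-- Fourth moments, stationarity of fourth-order cumulants and their integrability. -/
structure CumulantAssumption (b : HilbertBasis ι ℂ H) (P : Measure Ω)
    (X : EuclideanSpace ℝ (Fin d) → Ω → H) : Prop where
  memLp : ∀ t, MemLp (X t) 4 P
  stationary : ∀ t s w v τ,
    cum b P (X (t + τ)) (X (s + τ)) (X (w + τ)) (X (v + τ)) = cum b P (X t) (X s) (X w) (X v)
  integrable : ∃ δ > (0 : ℝ),
    (⨆ w, ∫⁻ u, ∫⁻ v, ⨆ l₁ ∈ Metric.ball (0 : EuclideanSpace ℝ (Fin d)) δ,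
      ⨆ l₂ ∈ Metric.ball (0 : EuclideanSpace ℝ (Fin d)) δ,
      ⨆ l₃ ∈ Metric.ball (0 : EuclideanSpace ℝ (Fin d)) δ,
        ‖cum b P (X (l₁ + u)) (X (l₂ + v)) (X (l₃ + w)) (X 0)‖ₑ) < ∞

end Assumptions

end SpectralDensity

end

/-! Up to the factor (2π)^{-d}, the error is a centred random fluctuation, plus a deterministic
sampling bias, minus the two integrals whose norms are B₁ and B₂ (`integral_character_smul_eq`).
Minkowski's inequality in L²(P) adds the four sizes (`rootMSE_le`).

Geometry. The rescaled regions converge to a convex set with interior and Δ_n^d = o(|T_n|), so T_n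
eventually contains a ball of radius AΔ_n for any fixed A. Convexity then keeps |T_n ∩ (T_n - h)|
above |T_n|/2 on the lags seen by the kernel and makes it Lipschitz in h with constant O(|T_n|).
Hence the lag weights are O(1/|T_n|) and change by O(δ_n/|T_n|) over distances 2δ_n.

Bias (`hsNorm_sum_sub_integral_le`). For cells V_i made disjoint, p_ij(h) = |V_j ∩ (V_i - h)|
integrates over h to |V_i||V_j| and sums over i, j to |T_n ∩ (T_n - h)|. The double sum over sites
minus the kernel integral is therefore a single integral of p_ij-weighted differences between the
lags t_i - t_j and h, which are at most 2δ_n apart. The weights contribute δ_n and the L¹-Hölder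
covariance contributes δ_n^γ.

Variance (`lintegral_hsNorm_weighted_sum_sq_le`). The second moment is a fourfold sum of
Hilbert-Schmidt covariances. Each is a cumulant plus two products of second-order terms, because X
is real (`enorm_outerCov_le`). Comparison with integrals bounds two of the four sums by constants
(`sum_four_le`). The other two give O(|T_n| Δ_n^d) by kernel support, and the squared weights
O(|T_n|^{-2}) leave Δ_n^d/|T_n|.

The products contain expectations E⟨X(s), X(u)⟩, which are traces of covariance operators; this is
where trace-norm control enters. The working seminorm `hsTraceNorm` is subadditive and measurable by
construction, and an approximate polar decomposition bounds it by twice the trace norm. -/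

open Filter MeasureTheory Topology
open scoped ENNReal NNReal Pointwise

noncomputable section

namespace SpectralDensity

/-! ### Hilbert-Schmidt norm and diagonal sums. -/

section HilbertSchmidt

variable {ι H : Type*} [NormedAddCommGroup H] [InnerProductSpace ℂ H]

/-- Distinct basis vectors are √2 apart, so balls of radius 1/2 around them are disjoint.
Countability makes the suprema and sums over the basis measurable and lets sums be exchanged with
integrals. -/
theorem _root_.HilbertBasis.countable [TopologicalSpace.SeparableSpace H]
    (b : HilbertBasis ι ℂ H) : Countable ι := by
  classical
  have hdist : ∀ i j, i ≠ j → 1 < dist (b i) (b j) := by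
    intro i j hij
    have h0 : inner ℂ (b i) (b j) = 0 := b.orthonormal.2 hij
    have h1 : ‖b i - b j‖ * ‖b i - b j‖ = ‖b i‖ * ‖b i‖ + ‖b j‖ * ‖b j‖ := by
      have := @norm_add_sq_eq_norm_sq_add_norm_sq_of_inner_eq_zero ℂ H _ _ _ (b i) (-b j)
        (by simp [h0])
      simpa [sub_eq_add_neg] using this
    rw [b.orthonormal.1 i, b.orthonormal.1 j] at h1
    rw [dist_eq_norm]
    nlinarith [norm_nonneg (b i - b j)]
  have hc := Set.PairwiseDisjoint.countable_of_isOpen (a := (Set.univ : Set ι))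
    (s := fun i => Metric.ball (b i) (1 / 2)) ?_ (fun i _ => Metric.isOpen_ball)
    (fun i _ => ⟨b i, by simp⟩)
  · exact Set.countable_univ_iff.1 hc
  · intro i _ j _ hij
    apply Metric.ball_disjoint_ball
    linarith [hdist i j hij]

theorem tsum_enorm_inner_sq (b : HilbertBasis ι ℂ H) (x : H) :
    ∑' j, ‖inner ℂ (b j) x‖ₑ ^ 2 = ‖x‖ₑ ^ 2 := by
  have h1 : HasSum (fun j => ‖inner ℂ (b j) x‖ ^ 2) (‖x‖ ^ 2) := by
    have h := (b.hasSum_inner_mul_inner x x).mapL Complex.reCLM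
    convert h using 1
    · ext j
      rw [← inner_conj_symm x (b j), mul_comm, Complex.mul_conj]
      simp [Complex.normSq_eq_norm_sq, -Complex.ofReal_pow]
    · simp [inner_self_eq_norm_sq_to_K, ← Complex.ofReal_pow]
  have h2 := ENNReal.ofReal_tsum_of_nonneg (fun j => by positivity) h1.summable
  rw [h1.tsum_eq] at h2
  simp only [← ofReal_norm, ← ENNReal.ofReal_pow (norm_nonneg _)]
  exact h2.symm

theorem hsNorm_sq (b : HilbertBasis ι ℂ H) (A : H →L[ℂ] H) :
    hsNorm b A ^ 2 = ∑' j, ‖A (b j)‖ₑ ^ 2 := by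
  rw [hsNorm, ← ENNReal.rpow_natCast, ← ENNReal.rpow_mul]
  norm_num

/-- The vector of values of an operator at finitely many elements of the basis. -/
def basisValues (b : HilbertBasis ι ℂ H) (F : Finset ι) :
    (H →L[ℂ] H) →L[ℂ] PiLp 2 (fun _ : F => H) :=
  ((PiLp.continuousLinearEquiv 2 ℂ (fun _ : F => H)).symm :
      ((_ : F) → H) →L[ℂ] PiLp 2 (fun _ : F => H)) ∘L
    ContinuousLinearMap.pi (fun j : F => ContinuousLinearMap.apply ℂ H (b j))

theorem enorm_basisValues_sq (b : HilbertBasis ι ℂ H) (F : Finset ι) (A : H →L[ℂ] H) :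
    ‖basisValues b F A‖ₑ ^ 2 = ∑ j ∈ F, ‖A (b j)‖ₑ ^ 2 := by
  have h : ‖basisValues b F A‖ ^ 2 = ∑ j ∈ F, ‖A (b j)‖ ^ 2 := by
    rw [PiLp.norm_sq_eq_of_L2, ← Finset.sum_coe_sort F]
    rfl
  simp only [← ofReal_norm, ← ENNReal.ofReal_pow (norm_nonneg _)]
  rw [h, ENNReal.ofReal_sum_of_nonneg (fun _ _ => by positivity)]

/-- As a supremum of norms of continuous linear maps into Hilbert spaces, the Hilbert-Schmidt norm
inherits the triangle inequality, the integral inequality and measurability, although the Bochner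
integrals are taken in operator norm. -/
theorem hsNorm_eq_iSup (b : HilbertBasis ι ℂ H) (A : H →L[ℂ] H) :
    hsNorm b A = ⨆ F : Finset ι, ‖basisValues b F A‖ₑ := by
  apply le_antisymm
  · rw [← ENNReal.pow_le_pow_left_iff two_ne_zero, hsNorm_sq, ENNReal.tsum_eq_iSup_sum]
    refine iSup_le fun F => ?_
    rw [← enorm_basisValues_sq]
    gcongr
    exact le_iSup (fun F : Finset ι => ‖basisValues b F A‖ₑ) F
  · refine iSup_le fun F => ?_
    rw [← ENNReal.pow_le_pow_left_iff two_ne_zero, hsNorm_sq, enorm_basisValues_sq]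
    exact ENNReal.sum_le_tsum F

theorem enorm_basisValues_le (b : HilbertBasis ι ℂ H) (F : Finset ι) (A : H →L[ℂ] H) :
    ‖basisValues b F A‖ₑ ≤ hsNorm b A := by
  rw [hsNorm_eq_iSup]
  exact le_iSup (fun F : Finset ι => ‖basisValues b F A‖ₑ) F

theorem hsNorm_zero (b : HilbertBasis ι ℂ H) : hsNorm b 0 = 0 := by
  simp [hsNorm_eq_iSup]

theorem hsNorm_add_le (b : HilbertBasis ι ℂ H) (A B : H →L[ℂ] H) :
    hsNorm b (A + B) ≤ hsNorm b A + hsNorm b B := by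
  rw [hsNorm_eq_iSup b (A + B)]
  refine iSup_le fun F => ?_
  rw [map_add]
  exact (enorm_add_le _ _).trans
    (add_le_add (enorm_basisValues_le b F A) (enorm_basisValues_le b F B))

theorem hsNorm_smul (b : HilbertBasis ι ℂ H) (c : ℂ) (A : H →L[ℂ] H) :
    hsNorm b (c • A) = ‖c‖ₑ * hsNorm b A := by
  simp only [hsNorm_eq_iSup, map_smul, enorm_smul, ENNReal.mul_iSup]

theorem hsNorm_sub_le (b : HilbertBasis ι ℂ H) (A B : H →L[ℂ] H) : hsNorm b (A - B) ≤ hsNorm b A + hsNorm b B := by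
  have h : hsNorm b (-B) = hsNorm b B := by
    rw [← neg_one_smul ℂ, hsNorm_smul]
    simp
  rw [sub_eq_add_neg, ← h]
  exact hsNorm_add_le b _ _

theorem hsNorm_sum_le {α : Type*} (b : HilbertBasis ι ℂ H) (s : Finset α)
    (A : α → H →L[ℂ] H) : hsNorm b (∑ i ∈ s, A i) ≤ ∑ i ∈ s, hsNorm b (A i) := by
  classical
  induction s using Finset.induction_on with
  | empty => simp [hsNorm_zero]
  | insert i s hi ih =>
    rw [Finset.sum_insert hi, Finset.sum_insert hi]
    exact (hsNorm_add_le b _ _).trans (by gcongr)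

theorem hsNorm_integral_le [CompleteSpace H] {α : Type*} [MeasurableSpace α] {μ : Measure α}
    (b : HilbertBasis ι ℂ H) (A : α → H →L[ℂ] H) :
    hsNorm b (∫ x, A x ∂μ) ≤ ∫⁻ x, hsNorm b (A x) ∂μ := by
  by_cases hA : Integrable A μ
  · rw [hsNorm_eq_iSup]
    refine iSup_le fun F => ?_
    rw [← ContinuousLinearMap.integral_comp_comm (basisValues b F) hA]
    exact (enorm_integral_le_lintegral_enorm _).trans
      (lintegral_mono fun x => enorm_basisValues_le b F (A x))
  -- A non-integrable family has Bochner integral zero.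
  · simp [integral_undef hA, hsNorm_zero]

theorem aemeasurable_hsNorm [Countable ι] {α : Type*} [MeasurableSpace α] {μ : Measure α}
    (b : HilbertBasis ι ℂ H) {A : α → H →L[ℂ] H} (hA : AEStronglyMeasurable A μ) :
    AEMeasurable (fun x => hsNorm b (A x)) μ := by
  simp only [hsNorm_eq_iSup]
  exact AEMeasurable.iSup fun F =>
    ((basisValues b F).continuous.comp_aestronglyMeasurable hA).enorm

/-- Both squares are the double sum of |⟨e_i, A e_j⟩|², summed in either order. -/
theorem hsNorm_adjoint [CompleteSpace H] (b : HilbertBasis ι ℂ H) (A : H →L[ℂ] H) :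
    hsNorm b (ContinuousLinearMap.adjoint A) = hsNorm b A := by
  refine (ENNReal.pow_right_strictMono two_ne_zero).injective ?_
  rw [hsNorm_sq, hsNorm_sq]
  simp_rw [← tsum_enorm_inner_sq b]
  rw [ENNReal.tsum_comm]
  congr! 5 with i j
  rw [ContinuousLinearMap.adjoint_inner_right, ← inner_conj_symm, RCLike.enorm_conj]

theorem enorm_apply_le_hsNorm [CompleteSpace H] (b : HilbertBasis ι ℂ H) (A : H →L[ℂ] H) (x : H) :
    ‖A x‖ₑ ≤ hsNorm b A * ‖x‖ₑ := by
  rw [← ENNReal.pow_le_pow_left_iff two_ne_zero, ← tsum_enorm_inner_sq b, mul_pow,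
    ← hsNorm_adjoint b A, hsNorm_sq, ← ENNReal.tsum_mul_right]
  refine ENNReal.tsum_le_tsum fun j => ?_
  rw [← ContinuousLinearMap.adjoint_inner_left, ← mul_pow]
  gcongr
  simp only [← ofReal_norm, ← ENNReal.ofReal_mul (norm_nonneg _)]
  exact ENNReal.ofReal_le_ofReal (norm_inner_le_norm _ _)

theorem enorm_le_hsNorm [CompleteSpace H] (b : HilbertBasis ι ℂ H) (A : H →L[ℂ] H) :
    ‖A‖ₑ ≤ hsNorm b A := by
  by_cases h : hsNorm b A = ∞
  · simp [h]
  rw [← ENNReal.ofReal_toReal h, ← ofReal_norm]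
  apply ENNReal.ofReal_le_ofReal
  refine A.opNorm_le_bound ENNReal.toReal_nonneg fun x => ?_
  have := ENNReal.toReal_mono (by finiteness) (enorm_apply_le_hsNorm b A x)
  simpa using this

theorem hsNorm_comp_le [CompleteSpace H] (b : HilbertBasis ι ℂ H) (A B : H →L[ℂ] H) :
    hsNorm b (A * B) ≤ ‖A‖ₑ * hsNorm b B := by
  rw [← ENNReal.pow_le_pow_left_iff two_ne_zero, mul_pow, hsNorm_sq, hsNorm_sq,
    ← ENNReal.tsum_mul_left]
  refine ENNReal.tsum_le_tsum fun j => ?_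
  rw [← mul_pow]
  gcongr
  exact A.le_opENorm (B (b j))

/-- The sum of the absolute values of the diagonal entries of an operator. -/
def traceSum (b : HilbertBasis ι ℂ H) (A : H →L[ℂ] H) : ℝ≥0∞ :=
  ∑' j, ‖inner ℂ (b j) (A (b j))‖ₑ

theorem traceSum_add_le (b : HilbertBasis ι ℂ H) (A B : H →L[ℂ] H) :
    traceSum b (A + B) ≤ traceSum b A + traceSum b B := by
  rw [traceSum, traceSum, traceSum, ← ENNReal.tsum_add]
  refine ENNReal.tsum_le_tsum fun j => ?_
  rw [add_apply, inner_add_right]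
  exact enorm_add_le _ _

theorem aemeasurable_traceSum [Countable ι] {α : Type*} [MeasurableSpace α] {μ : Measure α}
    (b : HilbertBasis ι ℂ H) {A : α → H →L[ℂ] H} (hA : AEStronglyMeasurable A μ) :
    AEMeasurable (fun x => traceSum b (A x)) μ := by
  refine AEMeasurable.tsum fun j => AEStronglyMeasurable.enorm ?_
  exact ((innerSL ℂ (b j)).continuous.comp
    (ContinuousLinearMap.apply ℂ H (b j)).continuous).comp_aestronglyMeasurable hA

/-- A measurable seminorm dominating the Hilbert-Schmidt norm and the trace, and dominated by the
trace norm up to a factor. -/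
def hsTraceNorm (b : HilbertBasis ι ℂ H) (A : H →L[ℂ] H) : ℝ≥0∞ := hsNorm b A + traceSum b A

theorem hsNorm_le_hsTraceNorm (b : HilbertBasis ι ℂ H) (A : H →L[ℂ] H) :
    hsNorm b A ≤ hsTraceNorm b A := le_self_add

theorem hsTraceNorm_add_le (b : HilbertBasis ι ℂ H) (A B : H →L[ℂ] H) :
    hsTraceNorm b (A + B) ≤ hsTraceNorm b A + hsTraceNorm b B := by
  refine (add_le_add (hsNorm_add_le b A B) (traceSum_add_le b A B)).trans (le_of_eq ?_)
  rw [hsTraceNorm, hsTraceNorm]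
  ring

theorem aemeasurable_hsTraceNorm [Countable ι] {α : Type*} [MeasurableSpace α] {μ : Measure α}
    (b : HilbertBasis ι ℂ H) {A : α → H →L[ℂ] H} (hA : AEStronglyMeasurable A μ) :
    AEMeasurable (fun x => hsTraceNorm b (A x)) μ :=
  (aemeasurable_hsNorm b hA).add (aemeasurable_traceSum b hA)

end HilbertSchmidt

/-! ### Comparison with the trace norm. -/

section TraceNorm

variable {ι H : Type*} [NormedAddCommGroup H] [InnerProductSpace ℂ H] [CompleteSpace H]

/-- The square root of the absolute value of an operator. -/
def sqrtAbs (A : H →L[ℂ] H) : H →L[ℂ] H := CFC.sqrt (CFC.abs A)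

theorem isSelfAdjoint_sqrtAbs (A : H →L[ℂ] H) : IsSelfAdjoint (sqrtAbs A) :=
  IsSelfAdjoint.of_nonneg (CFC.sqrt_nonneg _)

theorem sqrtAbs_mul_self (A : H →L[ℂ] H) : sqrtAbs A * sqrtAbs A = CFC.abs A :=
  CFC.sqrt_mul_sqrt_self _ (CFC.abs_nonneg A)

/-- Each diagonal entry ⟨|A|e_j, e_j⟩ equals ‖|A|^{1/2} e_j‖², which turns the trace norm into a
squared Hilbert-Schmidt norm. -/
theorem hsNorm_sqrtAbs_sq (b : HilbertBasis ι ℂ H) (A : H →L[ℂ] H) :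
    hsNorm b (sqrtAbs A) ^ 2 = traceNorm b A := by
  rw [hsNorm_sq, traceNorm]
  refine tsum_congr fun j => ?_
  have h : inner ℂ (CFC.abs A (b j)) (b j) = ((‖sqrtAbs A (b j)‖ ^ 2 : ℝ) : ℂ) := by
    rw [← sqrtAbs_mul_self, mul_apply_eq_comp]
    nth_rewrite 1 [← (isSelfAdjoint_sqrtAbs A).adjoint_eq]
    rw [ContinuousLinearMap.adjoint_inner_left, inner_self_eq_norm_sq_to_K]
    norm_cast
  rw [h, Complex.ofReal_re, ← ofReal_norm, ENNReal.ofReal_pow (norm_nonneg _)]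

theorem norm_abs_apply (A : H →L[ℂ] H) (x : H) : ‖CFC.abs A x‖ = ‖A x‖ := by
  have hsa : IsSelfAdjoint (CFC.abs A) := IsSelfAdjoint.of_nonneg (CFC.abs_nonneg A)
  have h : inner ℂ (CFC.abs A x) (CFC.abs A x) = inner ℂ (A x) (A x) := by
    nth_rewrite 1 [← hsa.adjoint_eq]
    rw [ContinuousLinearMap.adjoint_inner_left, ← mul_apply_eq_comp,
      CFC.abs_mul_abs, mul_apply_eq_comp, ContinuousLinearMap.star_eq_adjoint,
      ContinuousLinearMap.adjoint_inner_right]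
  rw [inner_self_eq_norm_sq_to_K, inner_self_eq_norm_sq_to_K] at h
  have h' : ‖CFC.abs A x‖ ^ 2 = ‖A x‖ ^ 2 := by exact_mod_cast h
  exact (pow_left_inj₀ (norm_nonneg _) (norm_nonneg _) two_ne_zero).1 h'

theorem hsNorm_abs (b : HilbertBasis ι ℂ H) (A : H →L[ℂ] H) :
    hsNorm b (CFC.abs A) = hsNorm b A := by
  simp only [hsNorm, ← ofReal_norm, norm_abs_apply]

/-- Factor |A| = |A|^{1/2}|A|^{1/2} and bound the operator norm of one factor by its Hilbert-Schmidt
norm. -/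
theorem hsNorm_le_traceNorm (b : HilbertBasis ι ℂ H) (A : H →L[ℂ] H) :
    hsNorm b A ≤ traceNorm b A := by
  rw [← hsNorm_abs, ← sqrtAbs_mul_self, ← hsNorm_sqrtAbs_sq, sq]
  exact (hsNorm_comp_le b _ _).trans (by gcongr; exact enorm_le_hsNorm b _)

/-- An approximate polar decomposition. -/
theorem exists_contraction_sub_mul_abs (A : H →L[ℂ] H) {ε : ℝ} (hε : 0 < ε) :
    ∃ U : H →L[ℂ] H, ‖U‖ ≤ 1 ∧ ‖A - U * CFC.abs A‖ ≤ ε := by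
  set S := CFC.abs A
  have hS : 0 ≤ S := CFC.abs_nonneg A
  -- The contraction is U = A(ε + |A|)⁻¹; the inverse exists because the spectrum of |A| is
  -- non-negative.
  have hunit : IsUnit (algebraMap ℝ (H →L[ℂ] H) ε + S) := by
    have hns : (-ε) ∉ spectrum ℝ S := fun h => by
      have := spectrum_nonneg_of_nonneg hS h
      linarith
    have h := (spectrum.notMem_iff.1 hns).neg
    convert h using 1
    simp [sub_eq_add_neg, add_comm]
  obtain ⟨u, hu⟩ := hunit
  have hnorm : ‖A * (↑u⁻¹ : H →L[ℂ] H)‖ ≤ 1 := by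
    refine ContinuousLinearMap.opNorm_le_bound _ zero_le_one fun x => ?_
    set y := (↑u⁻¹ : H →L[ℂ] H) x with hy
    have hx : x = ε • y + S y := by
      have h1 : (u : H →L[ℂ] H) ((↑u⁻¹ : H →L[ℂ] H) x) = x := by
        rw [← mul_apply_eq_comp, Units.mul_inv, one_apply_eq_self]
      rw [hu] at h1
      rw [← h1, add_apply, Algebra.algebraMap_eq_smul_one]
      rfl
    rw [mul_apply_eq_comp, ← hy, ← norm_abs_apply, one_mul]
    have hpos : 0 ≤ RCLike.re (inner ℂ (S y) y) :=
      ((ContinuousLinearMap.nonneg_iff_isPositive S).1 hS).re_inner_nonneg_left y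
    -- Expanding ‖εy + |A|y‖², the cross term is non-negative since |A| is positive.
    have h2 : ‖S y‖ ^ 2 ≤ ‖x‖ ^ 2 := by
      rw [hx, add_comm, @norm_add_sq ℂ H _ _ _ (S y) (ε • y), RCLike.real_smul_eq_coe_smul (K := ℂ) ε y,
        inner_smul_right, RCLike.re_ofReal_mul]
      nlinarith [sq_nonneg ‖((ε : ℝ) : ℂ) • y‖, mul_nonneg hε.le hpos]
    exact le_of_sq_le_sq h2 (norm_nonneg _)
  refine ⟨A * (↑u⁻¹ : H →L[ℂ] H), hnorm, ?_⟩
  -- From A = U(ε + |A|), the defect A - U|A| is exactly εU.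
  have h3 : A - A * (↑u⁻¹ : H →L[ℂ] H) * S = ε • (A * (↑u⁻¹ : H →L[ℂ] H)) := by
    have h4 : A = A * (↑u⁻¹ : H →L[ℂ] H) * u := by rw [mul_assoc, Units.inv_mul, mul_one]
    nth_rewrite 1 [h4]
    rw [hu, mul_add, add_sub_cancel_right, Algebra.algebraMap_eq_smul_one, mul_smul_comm, mul_one]
  rw [h3, norm_smul, Real.norm_of_nonneg hε.le]
  exact mul_le_of_le_one_right hε.le hnorm

/-- With R = |A|^{1/2} and A ≈ (UR)R, each entry ⟨e_j, A e_j⟩ is nearly ⟨(UR)* e_j, R e_j⟩. The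
arithmetic-geometric mean inequality bounds the sum by half of ‖UR‖² + ‖R‖² in Hilbert-Schmidt norm,
and each of these is at most the trace norm. -/
theorem traceSum_le_traceNorm (b : HilbertBasis ι ℂ H) (A : H →L[ℂ] H) :
    traceSum b A ≤ traceNorm b A := by
  rw [traceSum, ENNReal.tsum_eq_iSup_sum]
  refine iSup_le fun F => ENNReal.le_of_forall_pos_le_add fun ε hε _ => ?_
  -- The polar error is small only in operator norm, so it is shared among the finitely many entries
  -- of F; the added 1 covers empty F.
  obtain ⟨U, hU, hAU⟩ := exists_contraction_sub_mul_abs A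
    (show (0 : ℝ) < ε / (F.card + 1) by positivity)
  set R := sqrtAbs A
  set B := ContinuousLinearMap.adjoint (U * R)
  have hB : hsNorm b B ^ 2 ≤ traceNorm b A := by
    rw [hsNorm_adjoint, ← hsNorm_sqrtAbs_sq]
    gcongr
    refine (hsNorm_comp_le b _ _).trans ?_
    calc ‖U‖ₑ * hsNorm b R ≤ 1 * hsNorm b R := by
          gcongr
          rw [← ofReal_norm]
          exact ENNReal.ofReal_le_one.2 hU
      _ = hsNorm b R := one_mul _
  have hterm : ∀ j, ‖inner ℂ (b j) (A (b j))‖ₑ ≤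
      (‖B (b j)‖ₑ ^ 2 + ‖R (b j)‖ₑ ^ 2) / 2 + ENNReal.ofReal (ε / (F.card + 1)) := by
    intro j
    have hb : ‖b j‖ = 1 := b.orthonormal.1 j
    have h1 : inner ℂ (b j) (A (b j)) =
        inner ℂ (B (b j)) (R (b j)) + inner ℂ (b j) ((A - U * CFC.abs A) (b j)) := by
      rw [ContinuousLinearMap.adjoint_inner_left, ← inner_add_right, ← mul_apply_eq_comp,
        mul_assoc, sqrtAbs_mul_self, ← add_apply, add_sub_cancel]
    have h2 : ‖inner ℂ (b j) (A (b j))‖ ≤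
        (‖B (b j)‖ ^ 2 + ‖R (b j)‖ ^ 2) / 2 + ε / (F.card + 1) := by
      rw [h1]
      refine (norm_add_le _ _).trans (add_le_add ?_ ?_)
      · refine (norm_inner_le_norm _ _).trans ?_
        nlinarith [sq_nonneg (‖B (b j)‖ - ‖R (b j)‖)]
      · refine (norm_inner_le_norm _ _).trans ?_
        rw [hb, one_mul]
        refine ((A - U * CFC.abs A).le_opNorm (b j)).trans ?_
        rw [hb, mul_one]
        exact hAU
    rw [← ofReal_norm]
    refine (ENNReal.ofReal_le_ofReal h2).trans ?_
    rw [ENNReal.ofReal_add (by positivity) (by positivity), ENNReal.ofReal_div_of_pos two_pos,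
      ENNReal.ofReal_add (by positivity) (by positivity)]
    simp [ENNReal.ofReal_pow]
  calc ∑ j ∈ F, ‖inner ℂ (b j) (A (b j))‖ₑ
      ≤ ∑ j ∈ F, ((‖B (b j)‖ₑ ^ 2 + ‖R (b j)‖ₑ ^ 2) / 2 + ENNReal.ofReal (ε / (F.card + 1))) :=
        Finset.sum_le_sum fun j _ => hterm j
    _ = (∑ j ∈ F, ‖B (b j)‖ₑ ^ 2 + ∑ j ∈ F, ‖R (b j)‖ₑ ^ 2) / 2
          + F.card * ENNReal.ofReal (ε / (F.card + 1)) := by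
        rw [Finset.sum_add_distrib, Finset.sum_const, nsmul_eq_mul]
        simp only [div_eq_mul_inv]
        rw [← Finset.sum_mul, Finset.sum_add_distrib]
    _ ≤ (traceNorm b A + traceNorm b A) / 2 + ε := by
        gcongr
        · exact (ENNReal.sum_le_tsum F).trans ((hsNorm_sq b B).symm.le.trans hB)
        · exact (ENNReal.sum_le_tsum F).trans
            ((hsNorm_sq b R).symm.le.trans (hsNorm_sqrtAbs_sq b A).le)
        · rw [← ENNReal.ofReal_natCast, ← ENNReal.ofReal_mul (by positivity),
            ← ENNReal.ofReal_coe_nnreal]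
          apply ENNReal.ofReal_le_ofReal
          rw [mul_div_assoc', div_le_iff₀ (by positivity)]
          nlinarith [ε.2, hε]
    _ = traceNorm b A + ε := by rw [ENNReal.add_div, ENNReal.add_halves]

theorem enorm_le_traceNorm (b : HilbertBasis ι ℂ H) (A : H →L[ℂ] H) : ‖A‖ₑ ≤ traceNorm b A :=
  (enorm_le_hsNorm b A).trans (hsNorm_le_traceNorm b A)

theorem hsTraceNorm_le (b : HilbertBasis ι ℂ H) (A : H →L[ℂ] H) :
    hsTraceNorm b A ≤ 2 * traceNorm b A := by
  rw [two_mul]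
  exact add_le_add (hsNorm_le_traceNorm b A) (traceSum_le_traceNorm b A)

end TraceNorm

/-! ### Hilbert-Schmidt inner product and cross products. -/

section HilbertSchmidtInner

variable {ι H : Type*} [NormedAddCommGroup H] [InnerProductSpace ℂ H]

theorem summable_norm_sq_of_hsNorm_lt_top (b : HilbertBasis ι ℂ H) {A : H →L[ℂ] H}
    (hA : hsNorm b A < ∞) : Summable fun j => ‖A (b j)‖ ^ 2 := by
  have h : ∑' j, ‖A (b j)‖ₑ ^ 2 ≠ ∞ := by
    rw [← hsNorm_sq]
    exact ENNReal.pow_ne_top hA.ne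
  simpa using ENNReal.summable_toReal h

theorem hasSum_hsInner (b : HilbertBasis ι ℂ H) {A B : H →L[ℂ] H} (hA : hsNorm b A < ∞)
    (hB : hsNorm b B < ∞) :
    HasSum (fun j => inner ℂ (A (b j)) (B (b j))) (hsInner b A B) := by
  refine Summable.hasSum (Summable.of_norm_bounded
    (g := fun j => ‖A (b j)‖ ^ 2 + ‖B (b j)‖ ^ 2)
    ((summable_norm_sq_of_hsNorm_lt_top b hA).add (summable_norm_sq_of_hsNorm_lt_top b hB))
    fun j => (norm_inner_le_norm _ _).trans ?_)
  nlinarith [sq_nonneg (‖A (b j)‖ - ‖B (b j)‖), sq_nonneg (‖A (b j)‖ + ‖B (b j)‖)]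

theorem enorm_hsInner_le (b : HilbertBasis ι ℂ H) {A B : H →L[ℂ] H} (hA : hsNorm b A < ∞)
    (hB : hsNorm b B < ∞) : ‖hsInner b A B‖ₑ ≤ hsNorm b A * hsNorm b B := by
  refine le_of_tendsto (hasSum_hsInner b hA hB).enorm (Eventually.of_forall fun F => ?_)
  have h : ∑ j ∈ F, inner ℂ (A (b j)) (B (b j)) =
      inner ℂ (basisValues b F A) (basisValues b F B) := by
    rw [PiLp.inner_apply, ← Finset.sum_coe_sort F]
    rfl
  calc ‖∑ j ∈ F, inner ℂ (A (b j)) (B (b j))‖ₑ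
      ≤ ‖basisValues b F A‖ₑ * ‖basisValues b F B‖ₑ := by
        rw [h]
        simp only [← ofReal_norm, ← ENNReal.ofReal_mul (norm_nonneg _)]
        exact ENNReal.ofReal_le_ofReal (norm_inner_le_norm _ _)
    _ ≤ _ := mul_le_mul' (enorm_basisValues_le b F A) (enorm_basisValues_le b F B)

theorem outer_apply (x y z : H) : outer x y z = inner ℂ y z • x := rfl

theorem hsNorm_outer (b : HilbertBasis ι ℂ H) (x y : H) :
    hsNorm b (outer x y) = ‖x‖ₑ * ‖y‖ₑ := by
  refine (ENNReal.pow_right_strictMono two_ne_zero).injective ?_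
  rw [hsNorm_sq, mul_pow, ← tsum_enorm_inner_sq b y, ← ENNReal.tsum_mul_left]
  refine tsum_congr fun j => ?_
  rw [outer_apply, enorm_smul, ← inner_conj_symm, RCLike.enorm_conj, mul_pow, mul_comm]

theorem hasSum_norm_outer_sq (b : HilbertBasis ι ℂ H) (x y : H) :
    HasSum (fun j => ‖outer x y (b j)‖ ^ 2) ((‖x‖ * ‖y‖) ^ 2) := by
  have hfin : hsNorm b (outer x y) < ∞ := by
    rw [hsNorm_outer]
    finiteness
  have h := (summable_norm_sq_of_hsNorm_lt_top b hfin).hasSum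
  convert h using 1
  have h2 := hsNorm_sq b (outer x y)
  rw [hsNorm_outer] at h2
  have h3 := congrArg ENNReal.toReal h2
  rw [ENNReal.tsum_toReal_eq (fun j => by finiteness)] at h3
  simpa using h3

theorem continuous_outer : Continuous fun p : H × H => outer p.1 p.2 := by
  exact (isBoundedBilinearMap_smulRight (𝕜 := ℂ) (E := H) (F := H)).continuous.comp
    (((innerSL ℂ).continuous.comp continuous_snd).prodMk continuous_fst)

end HilbertSchmidtInner

/-! ### Second and fourth moments of cross products. -/

section Moments

variable {ι H Ω : Type*} [NormedAddCommGroup H] [InnerProductSpace ℂ H]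
  [MeasurableSpace Ω] {P : Measure Ω}

theorem aestronglyMeasurable_outer {Y Z : Ω → H} (hY : AEStronglyMeasurable Y P)
    (hZ : AEStronglyMeasurable Z P) :
    AEStronglyMeasurable (fun ω => outer (Y ω) (Z ω)) P :=
  Continuous.comp_aestronglyMeasurable (g := fun p : H × H => outer p.1 p.2)
    (f := fun ω => (Y ω, Z ω)) continuous_outer (hY.prodMk hZ)

theorem integrable_outer {Y Z : Ω → H} (hY : MemLp Y 2 P) (hZ : MemLp Z 2 P) :
    Integrable (fun ω => outer (Y ω) (Z ω)) P := by
  refine Integrable.mono (hY.norm.integrable_mul hZ.norm)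
    (aestronglyMeasurable_outer hY.1 hZ.1) (Eventually.of_forall fun ω => ?_)
  simp [outer]

theorem memLp_outer_apply {Y Z : Ω → H} (hY : MemLp Y 4 P) (hZ : MemLp Z 4 P) (x : H) :
    MemLp (fun ω => outer (Y ω) (Z ω) x) 2 P := by
  have : ENNReal.HolderTriple 4 4 2 := ⟨by
    rw [← two_mul, show (4 : ℝ≥0∞) = 2 * 2 by norm_num, ENNReal.mul_inv (by simp) (by simp),
      ← mul_assoc, ENNReal.mul_inv_cancel (by simp) (by simp), one_mul]⟩
  have h1 : MemLp (fun ω => inner ℂ (Z ω) x) 4 P := hZ.inner_const x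
  exact hY.smul h1

theorem covOp_apply {Y Z : Ω → H} (hY : MemLp Y 2 P) (hZ : MemLp Z 2 P) (x : H) :
    covOp P Y Z x = ∫ ω, outer (Y ω) (Z ω) x ∂P := by
  rw [covOp, ContinuousLinearMap.integral_apply (integrable_outer hY hZ)]

theorem covOp_congr {Y Y' Z Z' : Ω → H} (hY : Y =ᵐ[P] Y') (hZ : Z =ᵐ[P] Z') :
    covOp P Y Z = covOp P Y' Z' := by
  refine integral_congr_ae ?_
  filter_upwards [hY, hZ] with ω h1 h2
  rw [h1, h2]

/-- Dominated convergence: the squared column norms of the two cross products sum to (‖Y₁‖‖Y₂‖)² +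
(‖Y₃‖‖Y₄‖)², which is integrable by the fourth moments. -/
theorem hasSum_integral_inner_outer [Countable ι] (b : HilbertBasis ι ℂ H) {Y₁ Y₂ Y₃ Y₄ : Ω → H}
    (h₁ : MemLp Y₁ 4 P) (h₂ : MemLp Y₂ 4 P) (h₃ : MemLp Y₃ 4 P) (h₄ : MemLp Y₄ 4 P) :
    HasSum (fun j => ∫ ω, inner ℂ (outer (Y₁ ω) (Y₂ ω) (b j)) (outer (Y₃ ω) (Y₄ ω) (b j)) ∂P)
      (∫ ω, hsInner b (outer (Y₁ ω) (Y₂ ω)) (outer (Y₃ ω) (Y₄ ω)) ∂P) := by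
  have : ENNReal.HolderTriple 4 4 2 := ⟨by
    rw [← two_mul, show (4 : ℝ≥0∞) = 2 * 2 by norm_num, ENNReal.mul_inv (by simp) (by simp),
      ← mul_assoc, ENNReal.mul_inv_cancel (by simp) (by simp), one_mul]⟩
  have hsum : ∀ ω, HasSum (fun j => ‖outer (Y₁ ω) (Y₂ ω) (b j)‖ ^ 2 +
      ‖outer (Y₃ ω) (Y₄ ω) (b j)‖ ^ 2) ((‖Y₁ ω‖ * ‖Y₂ ω‖) ^ 2 + (‖Y₃ ω‖ * ‖Y₄ ω‖) ^ 2) :=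
    fun ω => (hasSum_norm_outer_sq b _ _).add (hasSum_norm_outer_sq b _ _)
  refine hasSum_integral_of_dominated_convergence (fun j ω => ‖outer (Y₁ ω) (Y₂ ω) (b j)‖ ^ 2 +
      ‖outer (Y₃ ω) (Y₄ ω) (b j)‖ ^ 2) (fun j => ?_) (fun j => ?_) ?_ ?_ ?_
  · exact (memLp_outer_apply h₁ h₂ _).1.inner (memLp_outer_apply h₃ h₄ _).1
  · refine Eventually.of_forall fun ω => (norm_inner_le_norm _ _).trans ?_
    nlinarith [sq_nonneg (‖outer (Y₁ ω) (Y₂ ω) (b j)‖ - ‖outer (Y₃ ω) (Y₄ ω) (b j)‖),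
      sq_nonneg (‖outer (Y₁ ω) (Y₂ ω) (b j)‖ + ‖outer (Y₃ ω) (Y₄ ω) (b j)‖)]
  · exact Eventually.of_forall fun ω => (hsum ω).summable
  · simp only [(hsum _).tsum_eq]
    have h12 : MemLp (fun ω => ‖Y₁ ω‖ * ‖Y₂ ω‖) 2 P := h₂.norm.mul h₁.norm
    have h34 : MemLp (fun ω => ‖Y₃ ω‖ * ‖Y₄ ω‖) 2 P := h₄.norm.mul h₃.norm
    exact h12.integrable_sq.add h34.integrable_sq
  · refine Eventually.of_forall fun ω => hasSum_hsInner b ?_ ?_ <;>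
    · rw [hsNorm_outer]
      finiteness

variable [CompleteSpace H]

theorem hsNorm_covOp_lt_top (b : HilbertBasis ι ℂ H) {Y Z : Ω → H} (hY : MemLp Y 2 P)
    (hZ : MemLp Z 2 P) : hsNorm b (covOp P Y Z) < ∞ := by
  refine (hsNorm_integral_le b _).trans_lt ?_
  simp only [hsNorm_outer]
  have h := (hY.norm.integrable_mul hZ.norm).2
  simpa [HasFiniteIntegral, enorm_mul] using h

/-- By Parseval, E⟨Y, Z⟩ is the trace of E[Z ⊗ Y]: its j-th diagonal entry is E⟨Y, e_j⟩⟨e_j, Z⟩. -/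
theorem enorm_integral_inner_le_traceSum [Countable ι] (b : HilbertBasis ι ℂ H) {Y Z : Ω → H}
    (hY : MemLp Y 2 P) (hZ : MemLp Z 2 P) :
    ‖∫ ω, inner ℂ (Y ω) (Z ω) ∂P‖ₑ ≤ traceSum b (covOp P Z Y) := by
  have hnorm : ∀ x : H, HasSum (fun j => ‖inner ℂ (b j) x‖ ^ 2) (‖x‖ ^ 2) := by
    intro x
    have h := tsum_enorm_inner_sq b x
    have hs := ENNReal.summable_toReal (f := fun j => ‖inner ℂ (b j) x‖ₑ ^ 2)
      (by rw [h]; finiteness)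
    have h3 := congrArg ENNReal.toReal h
    rw [ENNReal.tsum_toReal_eq (fun j => by finiteness)] at h3
    have := hs.hasSum
    rw [h3] at this
    simpa using this
  have hsum : ∀ ω, HasSum (fun j => ‖inner ℂ (b j) (Y ω)‖ ^ 2 + ‖inner ℂ (b j) (Z ω)‖ ^ 2)
      (‖Y ω‖ ^ 2 + ‖Z ω‖ ^ 2) := fun ω => (hnorm _).add (hnorm _)
  have h : HasSum (fun j => ∫ ω, inner ℂ (Y ω) (b j) * inner ℂ (b j) (Z ω) ∂P)
      (∫ ω, inner ℂ (Y ω) (Z ω) ∂P) := by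
    refine hasSum_integral_of_dominated_convergence
      (fun j ω => ‖inner ℂ (b j) (Y ω)‖ ^ 2 + ‖inner ℂ (b j) (Z ω)‖ ^ 2)
      (fun j => ?_) (fun j => ?_) ?_ ?_ ?_
    · exact (hY.inner_const (b j)).1.mul (hZ.const_inner (b j)).1
    · refine Eventually.of_forall fun ω => ?_
      rw [norm_mul, norm_inner_symm]
      nlinarith [sq_nonneg (‖inner ℂ (b j) (Y ω)‖ - ‖inner ℂ (b j) (Z ω)‖),
        sq_nonneg (‖inner ℂ (b j) (Y ω)‖ + ‖inner ℂ (b j) (Z ω)‖)]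
    · exact Eventually.of_forall fun ω => (hsum ω).summable
    · simp only [(hsum _).tsum_eq]
      exact hY.norm.integrable_sq.add hZ.norm.integrable_sq
    · exact Eventually.of_forall fun ω => b.hasSum_inner_mul_inner _ _
  refine le_of_tendsto h.enorm (Eventually.of_forall fun F => ?_)
  refine (enorm_sum_le _ _).trans (le_trans (le_of_eq ?_) (ENNReal.sum_le_tsum F))
  refine Finset.sum_congr rfl fun j _ => ?_
  rw [covOp_apply hZ hY, ← integral_inner]
  · simp only [outer_apply, inner_smul_right]
  · exact (ContinuousLinearMap.apply ℂ H (b j)).integrable_comp (integrable_outer hZ hY)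

theorem integral_norm_sq_sum_sub_integral [IsProbabilityMeasure P] {α : Type*} [Fintype α]
    (w : α → ℂ) {ξ : α → Ω → H} (hξ : ∀ a, MemLp (ξ a) 2 P) :
    ((∫ ω, ‖∑ a, w a • (ξ a ω - ∫ ω', ξ a ω' ∂P)‖ ^ 2 ∂P : ℝ) : ℂ) =
      ∑ a, ∑ c, (starRingEnd ℂ (w a) * w c) *
        ((∫ ω, inner ℂ (ξ a ω) (ξ c ω) ∂P)
          - inner ℂ (∫ ω, ξ a ω ∂P) (∫ ω, ξ c ω ∂P)) := by
  have hint : ∀ a, Integrable (ξ a) P := fun a => (hξ a).integrable one_le_two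
  have hin : ∀ a c, Integrable (fun ω => inner ℂ (ξ a ω) (ξ c ω)) P := fun a c =>
    ((hξ a).norm.integrable_mul (hξ c).norm).mono ((hξ a).1.inner (hξ c).1)
      (Eventually.of_forall fun ω => by simpa using norm_inner_le_norm (𝕜 := ℂ) _ _)
  have hpt : ∀ ω, ((‖∑ a, w a • (ξ a ω - ∫ ω', ξ a ω' ∂P)‖ ^ 2 : ℝ) : ℂ) =
      ∑ a, ∑ c, (starRingEnd ℂ (w a) * w c) *
        (inner ℂ (ξ a ω) (ξ c ω) - inner ℂ (ξ a ω) (∫ ω', ξ c ω' ∂P)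
          - inner ℂ (∫ ω', ξ a ω' ∂P) (ξ c ω)
          + inner ℂ (∫ ω', ξ a ω' ∂P) (∫ ω', ξ c ω' ∂P)) := by
    intro ω
    have h := inner_self_eq_norm_sq_to_K (𝕜 := ℂ) (∑ a, w a • (ξ a ω - ∫ ω', ξ a ω' ∂P))
    rw [Complex.ofReal_pow]
    refine h.symm.trans ?_
    rw [sum_inner]
    refine Finset.sum_congr rfl fun a _ => ?_
    rw [inner_sum]
    refine Finset.sum_congr rfl fun c _ => ?_
    rw [inner_smul_left, inner_smul_right, inner_sub_left, inner_sub_right, inner_sub_right]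
    ring
  rw [← integral_complex_ofReal]
  simp_rw [hpt]
  have hi1 : ∀ a c, Integrable (fun ω => inner ℂ (ξ a ω) (∫ ω', ξ c ω' ∂P)) P :=
    fun a c => (hint a).inner_const _
  have hi2 : ∀ a c, Integrable (fun ω => inner ℂ (∫ ω', ξ a ω' ∂P) (ξ c ω)) P :=
    fun a c => (hint c).const_inner _
  have hall : ∀ a c, Integrable (fun ω => (starRingEnd ℂ (w a) * w c) *
        (inner ℂ (ξ a ω) (ξ c ω) - inner ℂ (ξ a ω) (∫ ω', ξ c ω' ∂P)
          - inner ℂ (∫ ω', ξ a ω' ∂P) (ξ c ω)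
          + inner ℂ (∫ ω', ξ a ω' ∂P) (∫ ω', ξ c ω' ∂P))) P := fun a c =>
    ((((hin a c).sub (hi1 a c)).sub (hi2 a c)).add (integrable_const _)).const_mul _
  rw [integral_finsetSum _ fun a _ => integrable_finsetSum _ fun c _ => hall a c]
  refine Finset.sum_congr rfl fun a _ => ?_
  rw [integral_finsetSum _ fun c _ => hall a c]
  refine Finset.sum_congr rfl fun c _ => ?_
  rw [integral_const_mul]
  congr 1
  have hs1 : Integrable (fun ω => inner ℂ (ξ a ω) (ξ c ω)
      - inner ℂ (ξ a ω) (∫ ω', ξ c ω' ∂P)) P := (hin a c).sub (hi1 a c)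
  have hs2 : Integrable (fun ω => inner ℂ (ξ a ω) (ξ c ω) - inner ℂ (ξ a ω) (∫ ω', ξ c ω' ∂P)
      - inner ℂ (∫ ω', ξ a ω' ∂P) (ξ c ω)) P := hs1.sub (hi2 a c)
  rw [integral_add hs2 (integrable_const _), integral_sub hs1 (hi2 a c),
    integral_sub (hin a c) (hi1 a c), integral_inner (hint c)]
  have h3 : ∫ ω, inner ℂ (ξ a ω) (∫ ω', ξ c ω' ∂P) ∂P =
      inner ℂ (∫ ω', ξ a ω' ∂P) (∫ ω', ξ c ω' ∂P) := by
    rw [← inner_conj_symm, ← integral_inner (hint a), ← integral_conj]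
    simp
  rw [h3]
  simp

/-- The covariance, in the Hilbert-Schmidt inner product, of `Y₁ ⊗ Y₂` and `Y₃ ⊗ Y₄`. -/
def outerCov (b : HilbertBasis ι ℂ H) (P : Measure Ω) (Y₁ Y₂ Y₃ Y₄ : Ω → H) : ℂ :=
  (∫ ω, hsInner b (outer (Y₁ ω) (Y₂ ω)) (outer (Y₃ ω) (Y₄ ω)) ∂P)
    - hsInner b (covOp P Y₁ Y₂) (covOp P Y₃ Y₄)

/-- For each basis vector, the variance of the corresponding column expands into a finite double sum
of covariances; summing over the basis reassembles the Hilbert-Schmidt covariances. -/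
theorem lintegral_hsNorm_sum_sub_covOp_sq_le [Countable ι] [IsProbabilityMeasure P]
    (b : HilbertBasis ι ℂ H) {α : Type*} [Fintype α] (w : α → ℂ) {Y Z : α → Ω → H}
    (hY : ∀ a, MemLp (Y a) 4 P) (hZ : ∀ a, MemLp (Z a) 4 P) :
    ∫⁻ ω, hsNorm b (∑ a, w a • (outer (Y a ω) (Z a ω) - covOp P (Y a) (Z a))) ^ 2 ∂P ≤
      ∑ a, ∑ c, ‖w a‖ₑ * ‖w c‖ₑ * ‖outerCov b P (Y a) (Z a) (Y c) (Z c)‖ₑ := by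
  have hY2 : ∀ a, MemLp (Y a) 2 P := fun a => (hY a).mono_exponent (by norm_num)
  have hZ2 : ∀ a, MemLp (Z a) 2 P := fun a => (hZ a).mono_exponent (by norm_num)
  set ξ : ι → α → Ω → H := fun j a ω => outer (Y a ω) (Z a ω) (b j) with hξdef
  have hξ : ∀ j a, MemLp (ξ j a) 2 P := fun j a => memLp_outer_apply (hY a) (hZ a) _
  set V : ι → Ω → H := fun j ω => ∑ a, w a • (ξ j a ω - ∫ ω', ξ j a ω' ∂P) with hVdef
  have hV : ∀ j, MemLp (V j) 2 P := fun j =>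
    memLp_finsetSum _ fun a _ => ((hξ j a).sub (memLp_const _)).const_smul _
  have hVeq : ∀ j ω, (∑ a, w a • (outer (Y a ω) (Z a ω) - covOp P (Y a) (Z a))) (b j) = V j ω := by
    intro j ω
    simp only [hVdef, hξdef, sum_apply, smul_apply, sub_apply]
    refine Finset.sum_congr rfl fun a _ => ?_
    rw [covOp_apply (hY2 a) (hZ2 a)]
  simp_rw [hsNorm_sq, hVeq]
  rw [lintegral_tsum fun j => (hV j).1.enorm.pow_const 2]
  have hterm : ∀ j, ∫⁻ ω, ‖V j ω‖ₑ ^ 2 ∂P = ENNReal.ofReal (∫ ω, ‖V j ω‖ ^ 2 ∂P) := by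
    intro j
    rw [ofReal_integral_eq_lintegral_ofReal (hV j).norm.integrable_sq
      (Eventually.of_forall fun ω => by positivity)]
    simp [ENNReal.ofReal_pow]
  simp_rw [hterm]
  have hsum : HasSum (fun j => ((∫ ω, ‖V j ω‖ ^ 2 ∂P : ℝ) : ℂ))
      (∑ a, ∑ c, (starRingEnd ℂ (w a) * w c) * outerCov b P (Y a) (Z a) (Y c) (Z c)) := by
    simp_rw [hVdef, integral_norm_sq_sum_sub_integral w (hξ _)]
    refine hasSum_sum fun a _ => hasSum_sum fun c _ => HasSum.mul_left _ (HasSum.sub ?_ ?_)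
    · exact hasSum_integral_inner_outer b (hY a) (hZ a) (hY c) (hZ c)
    · have h := hasSum_hsInner b (hsNorm_covOp_lt_top b (hY2 a) (hZ2 a))
        (hsNorm_covOp_lt_top b (hY2 c) (hZ2 c))
      simpa only [covOp_apply (hY2 _) (hZ2 _)] using h
  have hre := hsum.mapL Complex.reCLM
  simp only [Complex.reCLM_apply, Complex.ofReal_re] at hre
  rw [← ENNReal.ofReal_tsum_of_nonneg (fun j => integral_nonneg fun ω => by positivity)
    hre.summable, hre.tsum_eq]
  refine (ENNReal.ofReal_le_ofReal (Complex.re_le_norm _)).trans ?_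
  rw [ofReal_norm]
  refine (enorm_sum_le _ _).trans (Finset.sum_le_sum fun a _ =>
    (enorm_sum_le _ _).trans (Finset.sum_le_sum fun c _ => ?_))
  rw [enorm_mul, enorm_mul, RCLike.enorm_conj]

/-- Solve the definition of the cumulant for the covariance. Reality of Y₂ and Y₄ turns the
pseudo-covariances into covariances; the scalar expectations are bounded through traces, the
remaining product by Cauchy-Schwarz. -/
theorem enorm_outerCov_le [Countable ι] (b : HilbertBasis ι ℂ H)
    [IsFiniteMeasure P] {Y₁ Y₂ Y₃ Y₄ : Ω → H}
    (h₁ : MemLp Y₁ 2 P) (h₂ : MemLp Y₂ 2 P) (h₃ : MemLp Y₃ 2 P) (h₄ : MemLp Y₄ 2 P)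
    (hr₂ : ∀ᵐ ω ∂P, conj b (Y₂ ω) = Y₂ ω) (hr₄ : ∀ᵐ ω ∂P, conj b (Y₄ ω) = Y₄ ω) :
    ‖outerCov b P Y₁ Y₂ Y₃ Y₄‖ₑ ≤ ‖cum b P Y₁ Y₂ Y₃ Y₄‖ₑ
      + hsTraceNorm b (covOp P Y₃ Y₁) * hsTraceNorm b (covOp P Y₂ Y₄)
      + hsTraceNorm b (covOp P Y₁ Y₄) * hsTraceNorm b (covOp P Y₃ Y₂) := by
  have h : outerCov b P Y₁ Y₂ Y₃ Y₄ = cum b P Y₁ Y₂ Y₃ Y₄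
      + (∫ ω, inner ℂ (Y₁ ω) (Y₃ ω) ∂P) * (∫ ω, inner ℂ (Y₄ ω) (Y₂ ω) ∂P)
      + hsInner b (covOp P Y₁ Y₄) (covOp P Y₃ Y₂) := by
    have e1 : covOp P Y₁ (fun ω => conj b (Y₄ ω)) = covOp P Y₁ Y₄ := covOp_congr (ae_eq_refl Y₁) hr₄
    have e2 : covOp P Y₃ (fun ω => conj b (Y₂ ω)) = covOp P Y₃ Y₂ := covOp_congr (ae_eq_refl Y₃) hr₂
    rw [cum, e1, e2, outerCov]
    ring
  rw [h]
  refine (enorm_add_le _ _).trans (add_le_add ((enorm_add_le _ _).trans (add_le_add le_rfl ?_)) ?_)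
  · rw [enorm_mul]
    exact mul_le_mul' ((enorm_integral_inner_le_traceSum b h₁ h₃).trans le_add_self)
      ((enorm_integral_inner_le_traceSum b h₄ h₂).trans le_add_self)
  · exact (enorm_hsInner_le b (hsNorm_covOp_lt_top b h₁ h₄) (hsNorm_covOp_lt_top b h₃ h₂)).trans
      (mul_le_mul' le_self_add le_self_add)

end Moments

/-! ### Voronoi cells. -/

section Cells

variable {d n : ℕ} (t : Fin n → EuclideanSpace ℝ (Fin d))

theorem region_eq : region t = convexHull ℝ (Set.range t) :=
  ((Set.finite_range t).isCompact_convexHull ℝ).isClosed.closure_eq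

theorem isCompact_region : IsCompact (region t) := by
  rw [region_eq]
  exact (Set.finite_range t).isCompact_convexHull ℝ

theorem convex_region : Convex ℝ (region t) := by
  rw [region_eq]
  exact convex_convexHull ℝ _

theorem measurableSet_region : MeasurableSet (region t) := (isCompact_region t).measurableSet

theorem cell_subset_region (i : Fin n) : cell t i ⊆ region t := fun _ hx => hx.1

theorem measurableSet_cell (i : Fin n) : MeasurableSet (cell t i) := by
  have h : cell t i = region t ∩ ⋂ j, {x | ‖x - t i‖ ≤ ‖x - t j‖} := by
    ext x
    simp [cell]
  rw [h]
  exact (measurableSet_region t).inter (MeasurableSet.iInter fun j =>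
    (isClosed_le (by fun_prop) (by fun_prop)).measurableSet)

theorem norm_sub_le_tessDiam {i : Fin n} {x : EuclideanSpace ℝ (Fin d)} (hx : x ∈ cell t i) :
    ‖x - t i‖ ≤ tessDiam t := by
  -- An unbounded real supremum would default to zero, so boundedness has to be supplied; it comes
  -- from compactness of the region.
  have hb : BddAbove (Set.range fun y : cell t i => ‖(y : EuclideanSpace ℝ (Fin d)) - t i‖) := by
    obtain ⟨R, hR⟩ := ((isCompact_region t).isBounded.subset_closedBall (t i))
    refine ⟨R, ?_⟩
    rintro _ ⟨y, rfl⟩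
    simpa [dist_eq_norm] using hR (cell_subset_region t i y.2)
  exact le_ciSup_of_le (Set.finite_range _).bddAbove i (le_ciSup hb ⟨x, hx⟩)

theorem tessDiam_nonneg : 0 ≤ tessDiam t :=
  Real.iSup_nonneg fun _ => Real.iSup_nonneg fun _ => norm_nonneg _

theorem exists_mem_cell {x : EuclideanSpace ℝ (Fin d)} (hx : x ∈ region t) : ∃ i, x ∈ cell t i := by
  have hne : Nonempty (Fin n) := by
    by_contra h
    rw [not_nonempty_iff] at h
    rw [region_eq, Set.range_eq_empty, convexHull_empty] at hx
    exact hx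
  obtain ⟨i, -, hi⟩ := Finset.exists_min_image Finset.univ (fun j => ‖x - t j‖)
    Finset.univ_nonempty
  exact ⟨i, hx, fun j => hi j (Finset.mem_univ j)⟩

theorem volume_cell_inter_cell {i j : Fin n} (hij : t i ≠ t j) :
    volume (cell t i ∩ cell t j) = 0 := by
  -- Points equidistant from two distinct sites lie on a hyperplane, which is null.
  refine measure_mono_null (t := (AffineSubspace.perpBisector (t i) (t j) : Set _)) ?_
    (Measure.addHaar_affineSubspace volume _ (by simpa using hij))
  rintro x ⟨hi, hj⟩
  rw [SetLike.mem_coe, AffineSubspace.mem_perpBisector_iff_dist_eq, dist_eq_norm, dist_eq_norm]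
  exact le_antisymm (hi.2 j) (hj.2 i)

/-- Voronoi cells with ties broken, so that they are pairwise disjoint. -/
def disjointCell (i : Fin n) : Set (EuclideanSpace ℝ (Fin d)) :=
  cell t i \ ⋃ j : Set.Iio i, cell t j

theorem disjointCell_subset_cell (i : Fin n) : disjointCell t i ⊆ cell t i := Set.sdiff_subset

theorem measurableSet_disjointCell (i : Fin n) : MeasurableSet (disjointCell t i) :=
  (measurableSet_cell t i).diff (MeasurableSet.iUnion fun j => measurableSet_cell t j)

theorem pairwise_disjoint_disjointCell :
    Pairwise (Function.onFun Disjoint (disjointCell t)) := by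
  have key : ∀ i j, i < j → Disjoint (disjointCell t i) (disjointCell t j) := by
    intro i j hij
    rw [Set.disjoint_left]
    intro x hi hj
    exact hj.2 (Set.mem_iUnion.2 ⟨⟨i, hij⟩, hi.1⟩)
  intro i j hij
  rcases lt_or_gt_of_ne hij with h | h
  · exact key i j h
  · exact (key j i h).symm

theorem iUnion_disjointCell : ⋃ i, disjointCell t i = region t := by
  classical
  refine Set.Subset.antisymm (Set.iUnion_subset fun i =>
    (disjointCell_subset_cell t i).trans (cell_subset_region t i)) fun x hx => ?_
  obtain ⟨i, hi, hmin⟩ := Finset.exists_min_image (Finset.univ.filter fun i => x ∈ cell t i)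
    (id : Fin n → Fin n) (by
      obtain ⟨i, hi⟩ := exists_mem_cell t hx
      exact ⟨i, by simp [hi]⟩)
  simp only [Finset.mem_filter, Finset.mem_univ, true_and, id] at hi hmin
  refine Set.mem_iUnion.2 ⟨i, hi, fun hx' => ?_⟩
  obtain ⟨⟨j, hj⟩, hxj⟩ := Set.mem_iUnion.1 hx'
  exact absurd (hmin j hxj) (not_le.2 hj)

theorem volume_disjointCell (ht : Function.Injective t) (i : Fin n) :
    volume (disjointCell t i) = volume (cell t i) := by
  rw [disjointCell, ← Set.sdiff_inter_self_eq_sdiff, measure_sdiff_null]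
  rw [Set.iUnion_inter, measure_iUnion_null_iff]
  rintro ⟨j, hj⟩
  exact volume_cell_inter_cell t fun h => (ne_of_lt hj) (ht h)

theorem volume_cell_lt_top (i : Fin n) : volume (cell t i) < ∞ :=
  (measure_mono (cell_subset_region t i)).trans_lt (isCompact_region t).measure_lt_top

end Cells

/-! ### Overlap of a convex body with its translates. -/

section Overlap

variable {d : ℕ} {R : Set (EuclideanSpace ℝ (Fin d))}

theorem image_sub_eq_preimage_add (h : EuclideanSpace ℝ (Fin d)) :
    (fun x => x - h) '' R = (fun x => x + h) ⁻¹' R := by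
  ext x
  constructor
  · rintro ⟨y, hy, rfl⟩
    simpa using hy
  · intro hx
    exact ⟨x + h, hx, by simp⟩

/-- Let ε = ‖k‖/ρ. Shrinking R by 1 - ε about x₀ gives a set inside both R and R - k, because (1 -
ε)x + εx₀ + k is a convex combination of x and x₀ + k/ε, and the latter lies in the inscribed ball.
The shrunken set has volume (1 - ε)^d |R|, at least (1 - dε)|R| by Bernoulli. -/
theorem measureReal_diff_preimage_add_le (hR : IsCompact R) (hconv : Convex ℝ R)
    {x₀ : EuclideanSpace ℝ (Fin d)} {ρ : ℝ} (hρ : 0 < ρ) (hball : Metric.closedBall x₀ ρ ⊆ R)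
    (k : EuclideanSpace ℝ (Fin d)) :
    volume.real (R \ (fun x => x + k) ⁻¹' R) ≤ d * (‖k‖ / ρ) * volume.real R := by
  rcases eq_or_ne k 0 with rfl | hk
  · simp
  have hfin : volume R ≠ ∞ := hR.measure_lt_top.ne
  set ε := ‖k‖ / ρ with hε
  have hεpos : 0 < ε := by positivity
  have hd : 1 ≤ d := by
    rcases Nat.eq_zero_or_pos d with rfl | h
    · exact absurd (Subsingleton.elim k 0) hk
    · exact h
  have hd' : (1 : ℝ) ≤ d := by exact_mod_cast hd
  -- For ε ≥ 1 the right-hand side already exceeds |R|, since d ≥ 1.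
  rcases le_or_gt 1 ε with h1 | h1
  · calc volume.real (R \ (fun x => x + k) ⁻¹' R) ≤ volume.real R :=
          measureReal_mono Set.sdiff_subset hfin
      _ = 1 * 1 * volume.real R := by ring
      _ ≤ d * ε * volume.real R := by gcongr
  set G := AffineMap.homothety x₀ (1 - ε) '' R
  have hG : G ⊆ R ∩ (fun x => x + k) ⁻¹' R := by
    rintro _ ⟨x, hx, rfl⟩
    have e1 : AffineMap.homothety x₀ (1 - ε) x = (1 - ε) • x + ε • x₀ := by
      rw [AffineMap.homothety_apply]
      simp only [vsub_eq_sub, vadd_eq_add]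
      module
    have hx₀ : x₀ ∈ R := hball (Metric.mem_closedBall_self hρ.le)
    refine ⟨?_, ?_⟩
    · rw [e1]
      exact hconv hx hx₀ (by linarith) hεpos.le (by ring)
    · rw [Set.mem_preimage, e1]
      have hk' : x₀ + ε⁻¹ • k ∈ R := by
        refine hball ?_
        rw [Metric.mem_closedBall, dist_eq_norm, add_sub_cancel_left, norm_smul, norm_inv,
          Real.norm_of_nonneg hεpos.le, hε]
        have : ‖k‖ ≠ 0 := norm_ne_zero_iff.2 hk
        field_simp
        exact le_rfl
      have e2 : (1 - ε) • x + ε • x₀ + k = (1 - ε) • x + ε • (x₀ + ε⁻¹ • k) := by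
        rw [smul_add, smul_inv_smul₀ hεpos.ne', add_assoc]
      rw [e2]
      exact hconv hx hk' (by linarith) hεpos.le (by ring)
  have hGvol : volume.real G = (1 - ε) ^ d * volume.real R := by
    rw [measureReal_def, Measure.addHaar_image_homothety, finrank_euclideanSpace_fin,
      abs_of_nonneg (by have : 0 ≤ 1 - ε := by linarith
                        positivity), ENNReal.toReal_mul, ENNReal.toReal_ofReal, measureReal_def]
    have : 0 ≤ 1 - ε := by linarith
    positivity
  have hmeas : MeasurableSet ((fun x => x + k) ⁻¹' R) :=
    measurable_id.add_const k hR.measurableSet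
  have hsplit := measureReal_inter_add_sdiff (μ := volume) (s := R) hmeas hfin
  have hGle : volume.real G ≤ volume.real (R ∩ (fun x => x + k) ⁻¹' R) :=
    measureReal_mono hG (measure_ne_top_of_subset Set.inter_subset_left hfin)
  have hbern := one_add_mul_le_pow (a := -ε) (by linarith) d
  have hRnn : 0 ≤ volume.real R := measureReal_nonneg
  have := mul_le_mul_of_nonneg_right hbern hRnn
  rw [← sub_eq_add_neg] at this
  nlinarith

/-- A point of R ∩ (R - h) outside R - h' is carried by the translation h into R but outside R - (h'
- h), so the previous estimate applies to the shift h' - h. -/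
theorem measureReal_inter_preimage_add_sub_le (hR : IsCompact R) (hconv : Convex ℝ R)
    {x₀ : EuclideanSpace ℝ (Fin d)} {ρ : ℝ} (hρ : 0 < ρ) (hball : Metric.closedBall x₀ ρ ⊆ R)
    (h h' : EuclideanSpace ℝ (Fin d)) :
    volume.real (R ∩ (fun x => x + h) ⁻¹' R) - volume.real (R ∩ (fun x => x + h') ⁻¹' R)
      ≤ d * (‖h - h'‖ / ρ) * volume.real R := by
  have hfin : volume R ≠ ∞ := hR.measure_lt_top.ne
  have hmeas : ∀ k, MeasurableSet ((fun x : EuclideanSpace ℝ (Fin d) => x + k) ⁻¹' R) :=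
    fun k => measurable_id.add_const k hR.measurableSet
  have hsub : R ∩ (fun x => x + h) ⁻¹' R ⊆ (R ∩ (fun x => x + h') ⁻¹' R) ∪
      (fun x => x + h) ⁻¹' (R \ (fun x => x + (h' - h)) ⁻¹' R) := by
    rintro x ⟨hx, hxh⟩
    by_cases hx' : x + h' ∈ R
    · exact Or.inl ⟨hx, hx'⟩
    · refine Or.inr ⟨hxh, fun hc => hx' ?_⟩
      simpa [add_assoc] using hc
  have htrans : volume.real ((fun x => x + h) ⁻¹' (R \ (fun x => x + (h' - h)) ⁻¹' R)) =
      volume.real (R \ (fun x => x + (h' - h)) ⁻¹' R) := by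
    rw [measureReal_def, measureReal_def, measure_preimage_add_right]
  have h1 := measureReal_diff_preimage_add_le hR hconv hρ hball (h' - h)
  have h2 : volume.real (R ∩ (fun x => x + h) ⁻¹' R) ≤
      volume.real (R ∩ (fun x => x + h') ⁻¹' R) +
        volume.real ((fun x => x + h) ⁻¹' (R \ (fun x => x + (h' - h)) ⁻¹' R)) := by
    refine (measureReal_mono hsub ?_).trans (measureReal_union_le _ _)
    refine measure_union_ne_top (measure_ne_top_of_subset Set.inter_subset_left hfin) ?_
    rw [measure_preimage_add_right]
    exact measure_ne_top_of_subset Set.sdiff_subset hfin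
  rw [htrans] at h2
  rw [norm_sub_rev] at h1
  linarith

variable {n : ℕ} (t : Fin n → EuclideanSpace ℝ (Fin d))

theorem overlapVol_eq (h : EuclideanSpace ℝ (Fin d)) :
    overlapVol t h = volume.real (region t ∩ (fun x => x + h) ⁻¹' region t) := by
  rw [overlapVol, image_sub_eq_preimage_add]

variable {t} {x₀ : EuclideanSpace ℝ (Fin d)} {ρ : ℝ}

theorem abs_overlapVol_sub_le (hρ : 0 < ρ) (hball : Metric.closedBall x₀ ρ ⊆ region t)
    (h h' : EuclideanSpace ℝ (Fin d)) :
    |overlapVol t h - overlapVol t h'| ≤ d * (‖h - h'‖ / ρ) * regionVol t := by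
  have key := measureReal_inter_preimage_add_sub_le (isCompact_region t) (convex_region t) hρ hball
  rw [abs_sub_le_iff, overlapVol_eq, overlapVol_eq]
  refine ⟨key h h', ?_⟩
  rw [norm_sub_rev]
  exact key h' h

theorem half_regionVol_le_overlapVol (hρ : 0 < ρ) (hball : Metric.closedBall x₀ ρ ⊆ region t)
    {h : EuclideanSpace ℝ (Fin d)} (hh : 2 * d * ‖h‖ ≤ ρ) :
    regionVol t / 2 ≤ overlapVol t h := by
  have h1 := (abs_sub_le_iff.1 (abs_overlapVol_sub_le hρ hball 0 h)).1
  have h0 : overlapVol t 0 = regionVol t := by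
    rw [overlapVol_eq, regionVol]
    simp
  rw [h0, zero_sub, norm_neg] at h1
  have h2 : d * (‖h‖ / ρ) ≤ 1 / 2 := by
    rw [mul_div_assoc', div_le_iff₀ hρ]
    linarith
  have hnn : 0 ≤ regionVol t := measureReal_nonneg
  nlinarith [mul_le_mul_of_nonneg_right h2 hnn]

end Overlap

/-! ### Large balls inside the sampling region. -/

section InscribedBall

variable {d : ℕ}

/-- If z in the smaller ball were outside S, let p be its projection onto S and push z a distance r
along z - p. The resulting point w is still in T, but the hyperplane through p normal to z - p
separates it from S, so its distance to S is at least r + ‖z - p‖. -/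
theorem closedBall_subset_of_hausdorffEDist_lt {S T : Set (EuclideanSpace ℝ (Fin d))}
    (hS : IsClosed S) (hSc : Convex ℝ S) {x₀ : EuclideanSpace ℝ (Fin d)} {r : ℝ} (hr : 0 < r)
    (hball : Metric.closedBall x₀ (2 * r) ⊆ T)
    (hdist : Metric.hausdorffEDist S T < ENNReal.ofReal r) : Metric.closedBall x₀ r ⊆ S := by
  intro z hz
  by_contra hzS
  rw [Metric.hausdorffEDist_comm] at hdist
  have hx₀ : x₀ ∈ T := hball (Metric.mem_closedBall_self (by linarith))
  obtain ⟨s₀, hs₀, -⟩ := Metric.exists_edist_lt_of_hausdorffEDist_lt hx₀ hdist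
  obtain ⟨p, hp, hmin⟩ := exists_norm_eq_iInf_of_complete_convex ⟨s₀, hs₀⟩ hS.isComplete hSc z
  rw [norm_eq_iInf_iff_real_inner_le_zero hSc hp] at hmin
  set v := z - p
  have hv : 0 < ‖v‖ := norm_pos_iff.2 (sub_ne_zero.2 fun h => hzS (h ▸ hp))
  set w := z + (r / ‖v‖) • v with hw
  have hwT : w ∈ T := by
    refine hball ?_
    rw [Metric.mem_closedBall, dist_eq_norm]
    rw [Metric.mem_closedBall, dist_eq_norm] at hz
    calc ‖w - x₀‖ = ‖(z - x₀) + (r / ‖v‖) • v‖ := by rw [hw]; congr 1; abel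
      _ ≤ ‖z - x₀‖ + ‖(r / ‖v‖) • v‖ := norm_add_le _ _
      _ ≤ r + r := by
          gcongr
          rw [norm_smul, Real.norm_of_nonneg (by positivity), div_mul_cancel₀ _ hv.ne']
      _ = 2 * r := by ring
  obtain ⟨s, hs, hws⟩ := Metric.exists_edist_lt_of_hausdorffEDist_lt hwT hdist
  have hws' : ‖w - s‖ < r := by
    rw [← dist_eq_norm]
    exact edist_lt_ofReal.1 hws
  have h1 := hmin s hs
  have h2 : inner ℝ v (w - s) = ‖v‖ ^ 2 + r * ‖v‖ - inner ℝ v (s - p) := by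
    have : w - s = v + (r / ‖v‖) • v - (s - p) := by
      rw [hw]
      simp only [v]
      abel
    rw [this, inner_sub_right, inner_add_right, inner_smul_right, real_inner_self_eq_norm_sq]
    congr 2
    field_simp
  have h3 := real_inner_le_norm v (w - s)
  nlinarith [mul_lt_mul_of_pos_left hws' hv, sq_nonneg ‖v‖]

/-- In dimension zero all volumes are bounded. Positivity of d is needed to invert the power 1/d. -/
theorem SamplingAssumption.dim_pos {t : (n : ℕ) → Fin n → EuclideanSpace ℝ (Fin d)}
    (hS : SamplingAssumption t) : d ≠ 0 := by
  rintro rfl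
  obtain ⟨n, hn⟩ := (hS.vol_tendsto.eventually_gt_atTop
    (volume.real (Set.univ : Set (EuclideanSpace ℝ (Fin 0))))).exists
  refine absurd hn (not_lt.2 (measureReal_mono (Set.subset_univ _) ?_))
  have : (Set.univ : Set (EuclideanSpace ℝ (Fin 0))) = {0} := by
    ext x
    simp [Subsingleton.elim x 0]
  rw [this]
  exact isCompact_singleton.measure_lt_top.ne

/-- The rescaled region eventually contains a fixed ball of radius r. Undoing the scaling gives
radius r|T_n|^{1/d}, which exceeds AΔ_n as soon as Δ_n^d/|T_n| < (r/A)^d. -/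
theorem SamplingAssumption.eventually_closedBall_subset
    {t : (n : ℕ) → Fin n → EuclideanSpace ℝ (Fin d)} (hS : SamplingAssumption t) {Δ : ℕ → ℝ}
    (hΔvol : Tendsto (fun n => Δ n ^ d / regionVol (t n)) atTop (𝓝 0))
    {A : ℝ} (hA : 0 < A) :
    ∀ᶠ n in atTop, ∃ x₀, Metric.closedBall x₀ (A * Δ n) ⊆ region (t n) := by
  have hd := hS.dim_pos
  obtain ⟨T, -, -, ⟨x, hx⟩, hT⟩ := hS.shape
  obtain ⟨ε, hε, hball⟩ := Metric.isOpen_iff.1 isOpen_interior x hx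
  set r := ε / 4 with hrdef
  have hr : 0 < r := by positivity
  have hball' : Metric.closedBall x (2 * r) ⊆ T :=
    (Metric.closedBall_subset_ball (by linarith)).trans (hball.trans interior_subset)
  have hAd : 0 < (r / A) ^ d := by positivity
  filter_upwards [hT.eventually (gt_mem_nhds (ENNReal.ofReal_pos.2 hr)),
    hΔvol.eventually (gt_mem_nhds hAd), hS.vol_tendsto.eventually_gt_atTop 0] with n h1 h2 h3
  set c := regionVol (t n) ^ (1 / (d : ℝ)) with hc
  have hcpos : 0 < c := Real.rpow_pos_of_pos h3 _
  have hcd : c ^ d = regionVol (t n) := by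
    rw [hc, one_div, Real.rpow_inv_natCast_pow h3.le hd]
  have hsub := closedBall_subset_of_hausdorffEDist_lt
    ((isCompact_region (t n)).smul c⁻¹).isClosed ((convex_region (t n)).smul c⁻¹) hr hball' h1
  have hle : A * Δ n ≤ c * r := by
    rw [← hcd, ← div_pow] at h2
    have := lt_of_pow_lt_pow_left₀ d (by positivity) h2
    rw [div_lt_div_iff₀ hcpos hA] at this
    linarith
  refine ⟨c • x, fun y hy => ?_⟩
  have hy' : c⁻¹ • y ∈ Metric.closedBall x r := by
    rw [Metric.mem_closedBall, dist_eq_norm] at hy ⊢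
    have : c⁻¹ • y - x = c⁻¹ • (y - c • x) := by rw [smul_sub, inv_smul_smul₀ hcpos.ne']
    rw [this, norm_smul, norm_inv, Real.norm_of_nonneg hcpos.le, inv_mul_le_iff₀ hcpos]
    exact hy.trans hle
  exact (Set.smul_mem_smul_set_iff₀ (inv_ne_zero hcpos.ne') _ _).1 (hsub hy')

end InscribedBall

/-! ### Sums over cells dominated by integrals. -/

section VoronoiSums

variable {d n : ℕ} {t : Fin n → EuclideanSpace ℝ (Fin d)}

/-- The left side is the integral of a measurable step function on disjoint cells, lying below F.
Thus F need not be measurable, which matters for the uncountable suprema used later. -/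
theorem sum_volume_cell_mul_le_lintegral (ht : Function.Injective t) (f : Fin n → ℝ≥0∞)
    (F : EuclideanSpace ℝ (Fin d) → ℝ≥0∞) (hF : ∀ i, ∀ x ∈ cell t i, f i ≤ F x) :
    ∑ i, volume (cell t i) * f i ≤ ∫⁻ x, F x := by
  have h : ∑ i, volume (cell t i) * f i =
      ∫⁻ x, ∑ i, (disjointCell t i).indicator (fun _ => f i) x := by
    rw [lintegral_finsetSum _ fun i _ => measurable_const.indicator (measurableSet_disjointCell t i)]
    refine Finset.sum_congr rfl fun i _ => ?_
    rw [lintegral_indicator_const (measurableSet_disjointCell t i), volume_disjointCell t ht,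
      mul_comm]
  rw [h]
  refine lintegral_mono fun x => ?_
  by_cases hx : ∃ i, x ∈ disjointCell t i
  · obtain ⟨i, hi⟩ := hx
    rw [Finset.sum_eq_single i]
    · rw [Set.indicator_of_mem hi]
      exact hF i x (disjointCell_subset_cell t i hi)
    · intro j _ hj
      exact Set.indicator_of_notMem
        (fun hxj => Set.disjoint_left.1 (pairwise_disjoint_disjointCell t hj) hxj hi) _
    · simp
  · push Not at hx
    simp [hx]

theorem sum_volume_cell (ht : Function.Injective t) :
    ∑ i, volume (cell t i) = volume (region t) := by
  rw [← iUnion_disjointCell, measure_iUnion (pairwise_disjoint_disjointCell t)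
    (measurableSet_disjointCell t), tsum_fintype]
  exact Finset.sum_congr rfl fun i _ => (volume_disjointCell t ht i).symm

/-- For fixed i, every cell whose site is within r of t_i lies in the ball of radius r plus the
tessellation diameter about t_i. -/
theorem sum_volume_cell_mul_indicator_le (ht : Function.Injective t) (r : ℝ) :
    ∑ i, ∑ j, volume (cell t i) * volume (cell t j) *
        (Metric.closedBall (0 : EuclideanSpace ℝ (Fin d)) r).indicator 1 (t i - t j) ≤
      volume (region t) *
        volume (Metric.closedBall (0 : EuclideanSpace ℝ (Fin d)) (r + tessDiam t)) := by
  rw [← sum_volume_cell ht, Finset.sum_mul]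
  refine Finset.sum_le_sum fun i _ => ?_
  simp_rw [mul_assoc]
  rw [← Finset.mul_sum]
  gcongr
  refine (sum_volume_cell_mul_le_lintegral ht _
    ((Metric.closedBall (t i) (r + tessDiam t)).indicator 1) fun j x hx => ?_).trans ?_
  · by_cases h : t i - t j ∈ Metric.closedBall (0 : EuclideanSpace ℝ (Fin d)) r
    · have hx' : x ∈ Metric.closedBall (t i) (r + tessDiam t) := by
        rw [mem_closedBall_zero_iff] at h
        rw [Metric.mem_closedBall, dist_eq_norm]
        calc ‖x - t i‖ = ‖(x - t j) - (t i - t j)‖ := by congr 1; abel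
          _ ≤ ‖x - t j‖ + ‖t i - t j‖ := norm_sub_le _ _
          _ ≤ r + tessDiam t := by linarith [norm_sub_le_tessDiam t hx]
      rw [Set.indicator_of_mem hx']
      exact Set.indicator_le_self' (fun _ _ => zero_le) _
    · rw [Set.indicator_of_notMem h]
      exact zero_le
  · rw [lintegral_indicator_one Metric.isClosed_closedBall.measurableSet,
      Measure.addHaar_closedBall_center]

theorem sum_sum_comm {α M : Type*} [Fintype α] [AddCommMonoid M] (f : α → α → α → α → M) :
    ∑ i, ∑ j, ∑ k, ∑ l, f i j k l = ∑ k, ∑ l, ∑ i, ∑ j, f i j k l := by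
  calc ∑ i, ∑ j, ∑ k, ∑ l, f i j k l = ∑ p : α × α, ∑ q : α × α, f p.1 p.2 q.1 q.2 := by
        simp only [Fintype.sum_prod_type]
    _ = ∑ q : α × α, ∑ p : α × α, f p.1 p.2 q.1 q.2 := Finset.sum_comm
    _ = _ := by simp only [Fintype.sum_prod_type]

/-- For the cumulant term, χ i j is dropped and the sums over i, j are bounded by B for fixed k, l.
For the two products, χ k l is dropped, and for fixed i, j the sums over k and l separate, each at
most S. The surviving pair sum is at most Q in every case. -/
theorem sum_four_le {α : Type*} [Fintype α] {V : α → ℝ≥0∞} {χ a : α → α → ℝ≥0∞}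
    {c : α → α → α → α → ℝ≥0∞} {B S Q : ℝ≥0∞} (hχ : ∀ i j, χ i j ≤ 1)
    (hc : ∀ k l, ∑ i, V i * ∑ j, V j * c i j k l ≤ B) (ha₁ : ∀ i, ∑ k, V k * a k i ≤ S)
    (ha₂ : ∀ i, ∑ k, V k * a i k ≤ S) (hQ : ∑ i, ∑ j, V i * V j * χ i j ≤ Q) :
    ∑ i, ∑ j, ∑ k, ∑ l, (V i * V j * χ i j) * (V k * V l * χ k l) *
      (c i j k l + a k i * a j l + a i l * a k j) ≤ Q * (B + 2 * S ^ 2) := by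
  have h1 : ∑ i, ∑ j, ∑ k, ∑ l, (V i * V j * χ i j) * (V k * V l * χ k l) * c i j k l
      ≤ Q * B := by
    calc ∑ i, ∑ j, ∑ k, ∑ l, (V i * V j * χ i j) * (V k * V l * χ k l) * c i j k l
        ≤ ∑ i, ∑ j, ∑ k, ∑ l, (V k * V l * χ k l) * (V i * (V j * c i j k l)) := by
          refine Finset.sum_le_sum fun i _ => Finset.sum_le_sum fun j _ =>
            Finset.sum_le_sum fun k _ => Finset.sum_le_sum fun l _ => ?_
          calc (V i * V j * χ i j) * (V k * V l * χ k l) * c i j k l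
              ≤ (V i * V j * 1) * (V k * V l * χ k l) * c i j k l := by gcongr; exact hχ i j
            _ = _ := by ring
      _ = ∑ k, ∑ l, (V k * V l * χ k l) * ∑ i, V i * ∑ j, V j * c i j k l := by
          simp_rw [Finset.mul_sum]
          exact sum_sum_comm _
      _ ≤ ∑ k, ∑ l, (V k * V l * χ k l) * B := by gcongr; exact hc _ _
      _ ≤ Q * B := by simp_rw [← Finset.sum_mul]; gcongr
  have h2 : ∀ f g : α → α → α → ℝ≥0∞, (∀ i j, ∑ k, V k * f i j k ≤ S) →
      (∀ i j, ∑ l, V l * g i j l ≤ S) →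
      ∑ i, ∑ j, ∑ k, ∑ l, (V i * V j * χ i j) * (V k * V l * χ k l) * (f i j k * g i j l)
        ≤ Q * S ^ 2 := by
    intro f g hf hg
    calc ∑ i, ∑ j, ∑ k, ∑ l, (V i * V j * χ i j) * (V k * V l * χ k l) * (f i j k * g i j l)
        ≤ ∑ i, ∑ j, ∑ k, ∑ l, (V i * V j * χ i j) * ((V k * f i j k) * (V l * g i j l)) := by
          refine Finset.sum_le_sum fun i _ => Finset.sum_le_sum fun j _ =>
            Finset.sum_le_sum fun k _ => Finset.sum_le_sum fun l _ => ?_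
          calc (V i * V j * χ i j) * (V k * V l * χ k l) * (f i j k * g i j l)
              ≤ (V i * V j * χ i j) * (V k * V l * 1) * (f i j k * g i j l) := by
                gcongr; exact hχ k l
            _ = _ := by ring
      _ = ∑ i, ∑ j, (V i * V j * χ i j) * ((∑ k, V k * f i j k) * ∑ l, V l * g i j l) := by
          simp_rw [Finset.sum_mul_sum, Finset.mul_sum]
      _ ≤ ∑ i, ∑ j, (V i * V j * χ i j) * (S * S) := by gcongr; exacts [hf _ _, hg _ _]
      _ ≤ Q * S ^ 2 := by simp_rw [← Finset.sum_mul]; rw [sq]; gcongr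
  have h3 := h2 (fun i _ k => a k i) (fun _ j l => a j l) (fun i _ => ha₁ i) fun _ j => ha₂ j
  have h4 := h2 (fun _ j k => a k j) (fun i _ l => a i l) (fun _ j => ha₁ j) fun i _ => ha₂ i
  simp_rw [mul_add, Finset.sum_add_distrib]
  refine (add_le_add (add_le_add h1 h3) ((le_of_eq ?_).trans h4)).trans (le_of_eq (by ring))
  simp_rw [mul_comm (a _ _) (a _ _)]

variable {ι H Ω : Type*} [NormedAddCommGroup H] [InnerProductSpace ℂ H] [CompleteSpace H]

/-- The oscillation of `C` in trace norm at scale `δ`. -/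
def traceOsc (b : HilbertBasis ι ℂ H) (C : EuclideanSpace ℝ (Fin d) → H →L[ℂ] H) (δ : ℝ)
    (x : EuclideanSpace ℝ (Fin d)) : ℝ≥0∞ :=
  ⨆ y ∈ Metric.closedBall x δ, traceNorm b (C y - C x)

theorem traceNorm_sub_le_traceOsc (b : HilbertBasis ι ℂ H)
    (C : EuclideanSpace ℝ (Fin d) → H →L[ℂ] H) {δ : ℝ} {x y : EuclideanSpace ℝ (Fin d)}
    (hxy : ‖y - x‖ ≤ δ) : traceNorm b (C y - C x) ≤ traceOsc b C δ x :=
  le_iSup₂_of_le y (by rwa [Metric.mem_closedBall, dist_eq_norm]) le_rfl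

theorem hsTraceNorm_le_add_traceOsc (b : HilbertBasis ι ℂ H)
    (C : EuclideanSpace ℝ (Fin d) → H →L[ℂ] H) {δ : ℝ} {x y : EuclideanSpace ℝ (Fin d)}
    (hxy : ‖y - x‖ ≤ δ) :
    hsTraceNorm b (C y) ≤ hsTraceNorm b (C x) + 2 * traceOsc b C δ x := by
  calc hsTraceNorm b (C y) = hsTraceNorm b (C x + (C y - C x)) := by congr 1; abel
    _ ≤ hsTraceNorm b (C x) + hsTraceNorm b (C y - C x) := hsTraceNorm_add_le b _ _
    _ ≤ hsTraceNorm b (C x) + 2 * traceOsc b C δ x := by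
        gcongr
        exact (hsTraceNorm_le b _).trans (by gcongr; exact traceNorm_sub_le_traceOsc b C hxy)

variable [Countable ι]

/-- Moving t_k to a point x of its cell changes the lag by at most the tessellation diameter, at the
cost of the oscillation; translation invariance then removes a. The variant below serves pairings in
which the summed site is subtracted. -/
theorem sum_volume_cell_mul_hsTraceNorm_sub_right_le (ht : Function.Injective t)
    (b : HilbertBasis ι ℂ H) {C : EuclideanSpace ℝ (Fin d) → H →L[ℂ] H}
    (hC : AEStronglyMeasurable C volume) (a : EuclideanSpace ℝ (Fin d)) :
    ∑ k, volume (cell t k) * hsTraceNorm b (C (t k - a)) ≤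
      (∫⁻ h, hsTraceNorm b (C h)) + 2 * ∫⁻ h, traceOsc b C (tessDiam t) h := by
  refine (sum_volume_cell_mul_le_lintegral ht _ (fun x => hsTraceNorm b (C (x - a)) +
    2 * traceOsc b C (tessDiam t) (x - a)) fun k x hx => ?_).trans (le_of_eq ?_)
  · refine hsTraceNorm_le_add_traceOsc b C ?_
    rw [sub_sub_sub_cancel_right, norm_sub_rev]
    exact norm_sub_le_tessDiam t hx
  · rw [lintegral_sub_right_eq_self (fun x => hsTraceNorm b (C x) +
      2 * traceOsc b C (tessDiam t) x) a, lintegral_add_left' (aemeasurable_hsTraceNorm b hC),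
      lintegral_const_mul' _ _ (by simp)]

theorem sum_volume_cell_mul_hsTraceNorm_sub_left_le (ht : Function.Injective t)
    (b : HilbertBasis ι ℂ H) {C : EuclideanSpace ℝ (Fin d) → H →L[ℂ] H}
    (hC : AEStronglyMeasurable C volume) (a : EuclideanSpace ℝ (Fin d)) :
    ∑ k, volume (cell t k) * hsTraceNorm b (C (a - t k)) ≤
      (∫⁻ h, hsTraceNorm b (C h)) + 2 * ∫⁻ h, traceOsc b C (tessDiam t) h := by
  refine (sum_volume_cell_mul_le_lintegral ht _ (fun x => hsTraceNorm b (C (a - x)) +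
    2 * traceOsc b C (tessDiam t) (a - x)) fun k x hx => ?_).trans (le_of_eq ?_)
  · refine hsTraceNorm_le_add_traceOsc b C ?_
    rw [sub_sub_sub_cancel_left]
    exact norm_sub_le_tessDiam t hx
  · rw [lintegral_sub_left_eq_self (fun x => hsTraceNorm b (C x) +
      2 * traceOsc b C (tessDiam t) x) a, lintegral_add_left' (aemeasurable_hsTraceNorm b hC),
      lintegral_const_mul' _ _ (by simp)]

/-- The suprema over l₁ and l₂ absorb the displacements from x and y to the sites of their cells;
the third argument is exact, so l₃ = 0. -/
theorem sum_volume_cell_mul_sum_le_lintegral_iSup (ht : Function.Injective t)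
    (c : EuclideanSpace ℝ (Fin d) → EuclideanSpace ℝ (Fin d) → EuclideanSpace ℝ (Fin d) → ℝ≥0∞)
    {δ : ℝ} (hδ : tessDiam t < δ) (a w : EuclideanSpace ℝ (Fin d)) :
    ∑ i, volume (cell t i) * ∑ j, volume (cell t j) * c (t i - a) (t j - a) w ≤
      ∫⁻ u, ∫⁻ v, ⨆ l₁ ∈ Metric.ball (0 : EuclideanSpace ℝ (Fin d)) δ,
        ⨆ l₂ ∈ Metric.ball (0 : EuclideanSpace ℝ (Fin d)) δ,
        ⨆ l₃ ∈ Metric.ball (0 : EuclideanSpace ℝ (Fin d)) δ, c (l₁ + u) (l₂ + v) (l₃ + w) := by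
  have hδ0 : 0 < δ := (tessDiam_nonneg t).trans_lt hδ
  have hmem : ∀ i, ∀ x ∈ cell t i, t i - x ∈ Metric.ball (0 : EuclideanSpace ℝ (Fin d)) δ := by
    intro i x hx
    rw [mem_ball_zero_iff, norm_sub_rev]
    exact (norm_sub_le_tessDiam t hx).trans_lt hδ
  set G : EuclideanSpace ℝ (Fin d) → EuclideanSpace ℝ (Fin d) → ℝ≥0∞ := fun u v =>
    ⨆ l₁ ∈ Metric.ball (0 : EuclideanSpace ℝ (Fin d)) δ,
      ⨆ l₂ ∈ Metric.ball (0 : EuclideanSpace ℝ (Fin d)) δ,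
      ⨆ l₃ ∈ Metric.ball (0 : EuclideanSpace ℝ (Fin d)) δ, c (l₁ + u) (l₂ + v) (l₃ + w) with hG
  refine (sum_volume_cell_mul_le_lintegral ht _ (fun x => ∫⁻ v, G (x - a) v)
    fun i x hx => ?_).trans (le_of_eq (lintegral_sub_right_eq_self (fun u => ∫⁻ v, G u v) a))
  refine (sum_volume_cell_mul_le_lintegral ht _ (fun y => G (x - a) (y - a))
    fun j y hy => ?_).trans (le_of_eq (lintegral_sub_right_eq_self (fun v => G (x - a) v) a))
  refine le_iSup₂_of_le (t i - x) (hmem i x hx) (le_iSup₂_of_le (t j - y) (hmem j y hy)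
    (le_iSup₂_of_le 0 (by simpa using hδ0) (le_of_eq ?_)))
  congr 1
  · abel
  · abel
  · abel

end VoronoiSums

/-! ### The double Riemann sum against its integral. -/

section RiemannSum

variable {d n : ℕ} {t : Fin n → EuclideanSpace ℝ (Fin d)}

/-- The volume of the set of `y` in the `j`-th cell such that `y + h` is in the `i`-th cell. -/
def cellOverlap (t : Fin n → EuclideanSpace ℝ (Fin d)) (i j : Fin n)
    (h : EuclideanSpace ℝ (Fin d)) : ℝ≥0∞ :=
  volume (disjointCell t j ∩ (fun y => y + h) ⁻¹' disjointCell t i)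

theorem measurableSet_cellOverlap (i j : Fin n) :
    MeasurableSet {p : EuclideanSpace ℝ (Fin d) × EuclideanSpace ℝ (Fin d) |
      p.2 ∈ disjointCell t j ∧ p.2 + p.1 ∈ disjointCell t i} :=
  (measurable_snd (measurableSet_disjointCell t j)).inter
    ((measurable_snd.add measurable_fst) (measurableSet_disjointCell t i))

theorem measurable_cellOverlap (i j : Fin n) : Measurable (cellOverlap t i j) :=
  measurable_measure_prodMk_left (measurableSet_cellOverlap i j)

/-- Tonelli on pairs (h, y): for fixed y in the j-th cell, the admissible h form a translate of the
i-th cell. -/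
theorem lintegral_cellOverlap (ht : Function.Injective t) (i j : Fin n) :
    ∫⁻ h, cellOverlap t i j h = volume (cell t i) * volume (cell t j) := by
  have h1 := Measure.prod_apply (μ := volume) (ν := volume)
    (measurableSet_cellOverlap (t := t) i j)
  have h2 := Measure.prod_apply_symm (μ := volume) (ν := volume)
    (measurableSet_cellOverlap (t := t) i j)
  refine (h1.symm.trans h2).trans ?_
  have h3 : ∀ y : EuclideanSpace ℝ (Fin d), volume ((fun h => (h, y)) ⁻¹'
      {p : EuclideanSpace ℝ (Fin d) × EuclideanSpace ℝ (Fin d) |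
        p.2 ∈ disjointCell t j ∧ p.2 + p.1 ∈ disjointCell t i}) =
      (disjointCell t j).indicator (fun _ => volume (cell t i)) y := by
    intro y
    by_cases hy : y ∈ disjointCell t j
    · rw [Set.indicator_of_mem hy, ← volume_disjointCell t ht i,
        ← measure_preimage_add volume y (disjointCell t i)]
      congr 1
      ext h
      simp [hy]
    · rw [Set.indicator_of_notMem hy]
      convert measure_empty (μ := (volume : Measure (EuclideanSpace ℝ (Fin d))))
      ext h
      simp [hy]
  simp_rw [h3]
  rw [lintegral_indicator_const (measurableSet_disjointCell t j), volume_disjointCell t ht]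

theorem sum_cellOverlap (h : EuclideanSpace ℝ (Fin d)) :
    ∑ i, ∑ j, cellOverlap t i j h = volume (region t ∩ (fun y => y + h) ⁻¹' region t) := by
  have hj : ∀ i, ∑ j, cellOverlap t i j h =
      volume (region t ∩ (fun y => y + h) ⁻¹' disjointCell t i) := by
    intro i
    rw [← iUnion_disjointCell, Set.iUnion_inter, measure_iUnion, tsum_fintype]
    · rfl
    · intro j j' hjj
      exact (pairwise_disjoint_disjointCell t hjj).mono Set.inter_subset_left Set.inter_subset_left
    · exact fun j => (measurableSet_disjointCell t j).inter
        (measurable_id.add_const h (measurableSet_disjointCell t i))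
  simp_rw [hj]
  nth_rewrite 3 [← iUnion_disjointCell]
  rw [Set.preimage_iUnion, Set.inter_iUnion, measure_iUnion, tsum_fintype]
  · intro j j' hjj
    exact ((pairwise_disjoint_disjointCell t hjj).preimage _).mono Set.inter_subset_right
      Set.inter_subset_right
  · exact fun i => (measurableSet_region t).inter
      (measurable_id.add_const h (measurableSet_disjointCell t i))

theorem sum_cellOverlap_le (h : EuclideanSpace ℝ (Fin d)) :
    ∑ i, ∑ j, cellOverlap t i j h ≤ volume (region t) := by
  rw [sum_cellOverlap]
  exact measure_mono Set.inter_subset_left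

theorem cellOverlap_lt_top (i j : Fin n) (h : EuclideanSpace ℝ (Fin d)) :
    cellOverlap t i j h < ∞ :=
  (measure_mono (Set.inter_subset_left.trans ((disjointCell_subset_cell t j).trans
    (cell_subset_region t j)))).trans_lt (isCompact_region t).measure_lt_top

theorem overlapVol_eq_sum (h : EuclideanSpace ℝ (Fin d)) :
    overlapVol t h = ∑ i, ∑ j, (cellOverlap t i j h).toReal := by
  rw [overlapVol_eq, measureReal_def, ← sum_cellOverlap, ENNReal.toReal_sum]
  · refine Finset.sum_congr rfl fun i _ => ENNReal.toReal_sum fun j _ => (cellOverlap_lt_top i j h).ne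
  · exact fun i _ => ENNReal.sum_ne_top.2 fun j _ => (cellOverlap_lt_top i j h).ne

theorem measurable_overlapVol : Measurable (overlapVol t) := by
  have : overlapVol t = fun h => ∑ i, ∑ j, (cellOverlap t i j h).toReal :=
    funext overlapVol_eq_sum
  rw [this]
  exact Finset.measurable_sum _ fun i _ => Finset.measurable_sum _ fun j _ =>
    (measurable_cellOverlap i j).ennreal_toReal

theorem norm_sub_le_of_cellOverlap_ne_zero {i j : Fin n} {h : EuclideanSpace ℝ (Fin d)}
    (hne : cellOverlap t i j h ≠ 0) : ‖t i - t j - h‖ ≤ 2 * tessDiam t := by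
  obtain ⟨y, hy, hyh⟩ := nonempty_of_measure_ne_zero hne
  have h1 := norm_sub_le_tessDiam t (disjointCell_subset_cell t j hy)
  have h2 := norm_sub_le_tessDiam t (disjointCell_subset_cell t i hyh)
  calc ‖t i - t j - h‖ = ‖(y - t j) - (y + h - t i)‖ := by congr 1; abel
    _ ≤ ‖y - t j‖ + ‖y + h - t i‖ := norm_sub_le _ _
    _ ≤ 2 * tessDiam t := by linarith

variable {ι H : Type*} [Countable ι] [NormedAddCommGroup H] [InnerProductSpace ℂ H]
  [CompleteSpace H]

/-- Replacing |V_i||V_j| by the integral of the cell overlap and |T ∩ (T - h)| by the sum of cell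
overlaps puts both terms under one integral. Only lags with ‖t_i - t_j - h‖ at most twice the
tessellation diameter contribute, and the total overlap at h is at most |T|. -/
theorem hsNorm_sum_sub_integral_le (ht : Function.Injective t) (b : HilbertBasis ι ℂ H)
    {C : EuclideanSpace ℝ (Fin d) → H →L[ℂ] H} (hC : AEStronglyMeasurable C volume)
    {q : EuclideanSpace ℝ (Fin d) → ℂ} (hq : Measurable q)
    (hqC : Integrable fun h => (q h * (overlapVol t h : ℂ)) • C h) {m κ : ℝ≥0∞} (hm : m ≠ ∞)
    (hqm : ∀ h, ‖q h‖ₑ ≤ m)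
    (hqκ : ∀ h h', ‖h' - h‖ ≤ 2 * tessDiam t → ‖q h' - q h‖ₑ ≤ κ) :
    hsNorm b (∑ i, ∑ j, (q (t i - t j) *
        (volume.real (cell t i) * volume.real (cell t j) : ℝ)) • C (t i - t j)
      - ∫ h, (q h * (overlapVol t h : ℂ)) • C h) ≤
      volume (region t) * (κ * (∫⁻ h, hsNorm b (C h))
        + m * ∫⁻ h, traceOsc b C (2 * tessDiam t) h) := by
  set p : Fin n → Fin n → EuclideanSpace ℝ (Fin d) → ℝ := fun i j h => (cellOverlap t i j h).toReal
    with hp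
  have hp0 : ∀ i j h, 0 ≤ p i j h := fun i j h => ENNReal.toReal_nonneg
  have hpm : ∀ i j, Measurable (p i j) := fun i j => (measurable_cellOverlap i j).ennreal_toReal
  have hpo : ∀ i j h, p i j h ≤ overlapVol t h := by
    intro i j h
    rw [overlapVol_eq_sum]
    exact (Finset.single_le_sum (f := fun j => p i j h) (fun j _ => hp0 i j h)
      (Finset.mem_univ j)).trans (Finset.single_le_sum (f := fun i => ∑ j, p i j h)
        (fun i _ => Finset.sum_nonneg fun j _ => hp0 i j h) (Finset.mem_univ i))
  have hlt : ∀ i j, ∫⁻ h, cellOverlap t i j h ≠ ∞ := fun i j => by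
    rw [lintegral_cellOverlap ht]
    exact (ENNReal.mul_lt_top (volume_cell_lt_top t i) (volume_cell_lt_top t j)).ne
  have hpi : ∀ i j, Integrable (p i j) := fun i j =>
    integrable_toReal_of_lintegral_ne_top (measurable_cellOverlap i j).aemeasurable (hlt i j)
  have hpint : ∀ i j, ∫ h, p i j h = volume.real (cell t i) * volume.real (cell t j) := by
    intro i j
    rw [hp, integral_toReal (measurable_cellOverlap i j).aemeasurable
      (Eventually.of_forall fun h => cellOverlap_lt_top i j h), lintegral_cellOverlap ht,
      ENNReal.toReal_mul]
    rfl
  have hi1 : ∀ i j, Integrable fun h => ((p i j h : ℂ) * q (t i - t j)) • C (t i - t j) :=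
    fun i j => ((hpi i j).ofReal.mul_const _).smul_const _
  have hi2 : ∀ i j, Integrable fun h => ((p i j h : ℂ) * q h) • C h := by
    intro i j
    refine hqC.mono ((((Complex.measurable_ofReal.comp (hpm i j)).mul hq).aestronglyMeasurable).smul
      hC) (Eventually.of_forall fun h => ?_)
    rw [norm_smul, norm_smul, norm_mul, norm_mul, mul_comm ‖q h‖]
    gcongr
    simp only [Complex.norm_real, Real.norm_eq_abs, abs_of_nonneg (hp0 i j h)]
    exact (hpo i j h).trans (le_abs_self _)
  have hi3 : ∀ i j, Integrable fun h => ((p i j h : ℂ) * q (t i - t j)) • C (t i - t j)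
      - ((p i j h : ℂ) * q h) • C h := fun i j => (hi1 i j).sub (hi2 i j)
  have hrep : ∑ i, ∑ j, (q (t i - t j) *
        (volume.real (cell t i) * volume.real (cell t j) : ℝ)) • C (t i - t j)
      - ∫ h, (q h * (overlapVol t h : ℂ)) • C h =
      ∫ h, ∑ i, ∑ j, (((p i j h : ℂ) * q (t i - t j)) • C (t i - t j)
        - ((p i j h : ℂ) * q h) • C h) := by
    have e1 : ∀ h, (q h * (overlapVol t h : ℂ)) • C h =
        ∑ i, ∑ j, ((p i j h : ℂ) * q h) • C h := by
      intro h
      simp_rw [← Finset.sum_smul, ← Finset.sum_mul]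
      rw [overlapVol_eq_sum, mul_comm]
      push_cast
      rfl
    simp_rw [e1]
    rw [integral_finsetSum _ fun i _ => integrable_finsetSum _ fun j _ => hi2 i j,
      integral_finsetSum _ fun i _ => integrable_finsetSum _ fun j _ => hi3 i j,
      ← Finset.sum_sub_distrib]
    refine Finset.sum_congr rfl fun i _ => ?_
    rw [integral_finsetSum _ fun j _ => hi2 i j,
      integral_finsetSum _ fun j _ => hi3 i j, ← Finset.sum_sub_distrib]
    refine Finset.sum_congr rfl fun j _ => ?_
    rw [integral_sub (hi1 i j) (hi2 i j), integral_smul_const, integral_mul_const,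
      integral_complex_ofReal, hpint, mul_comm (q _)]
  rw [hrep]
  refine (hsNorm_integral_le b _).trans ?_
  have hpt : ∀ h, hsNorm b (∑ i, ∑ j, (((p i j h : ℂ) * q (t i - t j)) • C (t i - t j)
        - ((p i j h : ℂ) * q h) • C h)) ≤
      volume (region t) * (κ * hsNorm b (C h) + m * traceOsc b C (2 * tessDiam t) h) := by
    intro h
    calc hsNorm b (∑ i, ∑ j, (((p i j h : ℂ) * q (t i - t j)) • C (t i - t j)
          - ((p i j h : ℂ) * q h) • C h))
        ≤ ∑ i, ∑ j, cellOverlap t i j h *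
            (κ * hsNorm b (C h) + m * traceOsc b C (2 * tessDiam t) h) := by
          refine (hsNorm_sum_le b _ _).trans (Finset.sum_le_sum fun i _ =>
            (hsNorm_sum_le b _ _).trans (Finset.sum_le_sum fun j _ => ?_))
          -- The weight increment is paired with C at the integration variable h, and the increment
          -- of C with the bounded weight.
          have e2 : ((p i j h : ℂ) * q (t i - t j)) • C (t i - t j) - ((p i j h : ℂ) * q h) • C h =
              (p i j h : ℂ) • ((q (t i - t j) - q h) • C h
                + q (t i - t j) • (C (t i - t j) - C h)) := by
            module
          have e3 : ‖(p i j h : ℂ)‖ₑ = cellOverlap t i j h := by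
            rw [← ofReal_norm, Complex.norm_real, Real.norm_of_nonneg (hp0 i j h)]
            exact ENNReal.ofReal_toReal (cellOverlap_lt_top i j h).ne
          rw [e2, hsNorm_smul, e3]
          by_cases h0 : cellOverlap t i j h = 0
          · simp [h0]
          have hclose := norm_sub_le_of_cellOverlap_ne_zero h0
          gcongr
          refine (hsNorm_add_le b _ _).trans ?_
          rw [hsNorm_smul, hsNorm_smul]
          gcongr
          · exact hqκ _ _ hclose
          · exact hqm _
          · exact (hsNorm_le_traceNorm b _).trans (traceNorm_sub_le_traceOsc b C hclose)
      _ = (∑ i, ∑ j, cellOverlap t i j h) *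
            (κ * hsNorm b (C h) + m * traceOsc b C (2 * tessDiam t) h) := by
          simp_rw [Finset.sum_mul]
      _ ≤ _ := by gcongr; exact sum_cellOverlap_le h
  refine (lintegral_mono hpt).trans (le_of_eq ?_)
  have hvol : volume (region t) ≠ ∞ := (isCompact_region t).measure_lt_top.ne
  -- The oscillation need not be measurable: its factors are pulled out because they are finite, and
  -- the integral is split using measurability of the Hilbert-Schmidt summand alone.
  rw [lintegral_const_mul' _ _ hvol,
    lintegral_add_left' ((aemeasurable_hsNorm b hC).const_mul κ), lintegral_const_mul' m _ hm,
    lintegral_const_mul'' κ (aemeasurable_hsNorm b hC)]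

end RiemannSum

/-! ### Characters. -/

section Character

variable {d : ℕ}

theorem norm_character (h θ : EuclideanSpace ℝ (Fin d)) : ‖character h θ‖ = 1 := by
  rw [character, mul_comm, Complex.norm_exp_ofReal_mul_I]

theorem continuous_character (θ : EuclideanSpace ℝ (Fin d)) :
    Continuous fun h => character h θ := by
  unfold character
  fun_prop

theorem norm_character_sub_le (h h' θ : EuclideanSpace ℝ (Fin d)) :
    ‖character h' θ - character h θ‖ ≤ ‖θ‖ * ‖h' - h‖ := by
  have e : character h' θ - character h θ = character h θ *
      (Complex.exp (Complex.I * ((inner ℝ (h' - h) θ : ℝ) : ℂ)) - 1) := by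
    rw [mul_sub, mul_one, character, character, ← Complex.exp_add, inner_sub_left]
    push_cast
    ring_nf
  rw [e, norm_mul, norm_character, one_mul]
  refine Real.norm_exp_I_mul_ofReal_sub_one_le.trans ?_
  rw [mul_comm]
  exact norm_inner_le_norm _ _

end Character

/-! ### Size and regularity of the lag weights. -/

section Kernel

variable {d n : ℕ} {K : EuclideanSpace ℝ (Fin d) → ℝ}

theorem KernelAssumption.continuous (hK : KernelAssumption K) : Continuous K :=
  hK.lipschitz.choose_spec.continuous

theorem KernelAssumption.exists_norm_le (hK : KernelAssumption K) :
    ∃ R > 0, ∀ u, K u ≠ 0 → ‖u‖ ≤ R := by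
  obtain ⟨R, hR, hsub⟩ := hK.isBounded_supp.subset_closedBall_lt 0 0
  refine ⟨R, hR, fun u hu => ?_⟩
  have := hsub (show u ∈ kernelSupp K from lt_of_le_of_ne (hK.nonneg u) hu.symm)
  simpa using this

/-- The weight `e^{i hᵀθ} K(h/Δ) / |T ∩ (T - h)|` of the lag `h` in the estimator. -/
def lagWeight (K : EuclideanSpace ℝ (Fin d) → ℝ) (t : Fin n → EuclideanSpace ℝ (Fin d)) (Δ : ℝ)
    (θ h : EuclideanSpace ℝ (Fin d)) : ℂ :=
  character h θ * ((K (Δ⁻¹ • h) / overlapVol t h : ℝ) : ℂ)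

variable {t : Fin n → EuclideanSpace ℝ (Fin d)} {Δ : ℝ}

theorem measurable_lagWeight (hK : Continuous K) (θ : EuclideanSpace ℝ (Fin d)) :
    Measurable (lagWeight K t Δ θ) := by
  have h1 : Continuous fun h : EuclideanSpace ℝ (Fin d) => K (Δ⁻¹ • h) := by fun_prop
  exact (continuous_character θ).measurable.mul
    (Complex.measurable_ofReal.comp (h1.measurable.div measurable_overlapVol))

variable {x₀ : EuclideanSpace ℝ (Fin d)} {ρ R : ℝ}

theorem norm_le_of_kernel_ne_zero (hΔ : 0 < Δ) (hR : ∀ u, K u ≠ 0 → ‖u‖ ≤ R)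
    {h : EuclideanSpace ℝ (Fin d)} (hh : K (Δ⁻¹ • h) ≠ 0) : ‖h‖ ≤ R * Δ := by
  have := hR _ hh
  rwa [norm_smul, norm_inv, Real.norm_of_nonneg hΔ.le, inv_mul_le_iff₀ hΔ, mul_comm] at this

/-- Where the kernel is non-zero the overlap is at least |T|/2; elsewhere the weight vanishes. -/
theorem norm_lagWeight_le (hK : KernelAssumption K) (hΔ : 0 < Δ)
    (hR : ∀ u, K u ≠ 0 → ‖u‖ ≤ R) (hρ : 0 < ρ) (hball : Metric.closedBall x₀ ρ ⊆ region t)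
    (hRρ : 2 * d * (R * Δ) ≤ ρ) (hvol : 0 < regionVol t) (θ h : EuclideanSpace ℝ (Fin d)) :
    ‖lagWeight K t Δ θ h‖ ≤ 2 / regionVol t := by
  rw [lagWeight, norm_mul, norm_character, one_mul, Complex.norm_real]
  by_cases h0 : K (Δ⁻¹ • h) = 0
  · rw [h0, zero_div, norm_zero]
    positivity
  have hov := half_regionVol_le_overlapVol hρ hball (h := h)
    ((mul_le_mul_of_nonneg_left (norm_le_of_kernel_ne_zero hΔ hR h0) (by positivity)).trans hRρ)
  have hpos : 0 < overlapVol t h := by linarith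
  rw [Real.norm_of_nonneg (div_nonneg (hK.nonneg _) hpos.le), div_le_div_iff₀ hpos hvol]
  nlinarith [hK.le_one (Δ⁻¹ • h), hK.nonneg (Δ⁻¹ • h)]

theorem lagWeight_mul_overlapVol (hΔ : 0 < Δ)
    (hR : ∀ u, K u ≠ 0 → ‖u‖ ≤ R) (hρ : 0 < ρ) (hball : Metric.closedBall x₀ ρ ⊆ region t)
    (hRρ : 2 * d * (R * Δ) ≤ ρ) (hvol : 0 < regionVol t) (θ h : EuclideanSpace ℝ (Fin d)) :
    lagWeight K t Δ θ h * (overlapVol t h : ℂ) = character h θ * (K (Δ⁻¹ • h) : ℂ) := by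
  rw [lagWeight, mul_assoc, ← Complex.ofReal_mul]
  by_cases h0 : K (Δ⁻¹ • h) = 0
  · simp [h0]
  have hov := half_regionVol_le_overlapVol hρ hball (h := h)
    ((mul_le_mul_of_nonneg_left (norm_le_of_kernel_ne_zero hΔ hR h0) (by positivity)).trans hRρ)
  rw [div_mul_cancel₀ _ (by linarith)]

/-- The three factors are varied one at a time. The character gives 2τδ · 2/|T|, the kernel 2Lδ ·
2/|T| as Δ ≥ 1, and the inverse overlap 2dδ|T| · (2/|T|)² as ρ ≥ 1. -/
theorem norm_lagWeight_sub_le (hK : KernelAssumption K) {L : ℝ≥0} (hL : LipschitzWith L K)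
    (hΔ : 1 ≤ Δ) (hR : ∀ u, K u ≠ 0 → ‖u‖ ≤ R) (hρ : 1 ≤ ρ)
    (hball : Metric.closedBall x₀ ρ ⊆ region t) (hRρ : 2 * d * (R * Δ + 2) ≤ ρ)
    (hvol : 0 < regionVol t) {δ : ℝ} (hδ : δ ≤ 1) {θ h h' : EuclideanSpace ℝ (Fin d)} {τ : ℝ}
    (hτ : ‖θ‖ ≤ τ) (hhh : ‖h' - h‖ ≤ 2 * δ) :
    ‖lagWeight K t Δ θ h' - lagWeight K t Δ θ h‖ ≤ (4 * τ + 4 * L + 8 * d) * δ / regionVol t := by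
  have hδ0 : 0 ≤ δ := by linarith [norm_nonneg (h' - h)]
  have hτ0 : 0 ≤ τ := (norm_nonneg θ).trans hτ
  have hΔ0 : 0 < Δ := by linarith
  have hρ0 : 0 < ρ := by linarith
  set v := regionVol t with hv
  set k := K (Δ⁻¹ • h) with hk
  set k' := K (Δ⁻¹ • h') with hk'
  set o := overlapVol t h with ho
  set o' := overlapVol t h' with ho'
  by_cases h00 : k = 0 ∧ k' = 0
  · rw [lagWeight, lagWeight, ← hk, ← hk', h00.1, h00.2]
    simp only [zero_div, Complex.ofReal_zero, mul_zero, sub_zero, norm_zero]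
    positivity
  -- One of the two lags is in the kernel support and the other is within 2δ ≤ 2 of it; hence the
  -- margin 2 in the hypothesis on ρ.
  have hnear : ‖h‖ ≤ R * Δ + 2 ∧ ‖h'‖ ≤ R * Δ + 2 := by
    rw [not_and_or] at h00
    rcases h00 with h0 | h0
    · have h1 := norm_le_of_kernel_ne_zero hΔ0 hR h0
      have h2 := norm_le_norm_add_norm_sub' h' h
      constructor <;> linarith
    · have h1 := norm_le_of_kernel_ne_zero hΔ0 hR h0
      have h2 := norm_le_norm_add_norm_sub h' h
      constructor <;> linarith
  have hov : v / 2 ≤ o := half_regionVol_le_overlapVol hρ0 hball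
    ((mul_le_mul_of_nonneg_left hnear.1 (by positivity)).trans hRρ)
  have hov' : v / 2 ≤ o' := half_regionVol_le_overlapVol hρ0 hball
    ((mul_le_mul_of_nonneg_left hnear.2 (by positivity)).trans hRρ)
  have hopos : 0 < o := by linarith
  have hopos' : 0 < o' := by linarith
  have hinv' : 1 / o' ≤ 2 / v := by
    rw [div_le_div_iff₀ hopos' hvol]
    linarith
  have hinv : 1 / o ≤ 2 / v := by
    rw [div_le_div_iff₀ hopos hvol]
    linarith
  have hk1 : |k| ≤ 1 := abs_le.2 ⟨by linarith [hK.nonneg (Δ⁻¹ • h)], hK.le_one _⟩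
  have hk1' : |k'| ≤ 1 := abs_le.2 ⟨by linarith [hK.nonneg (Δ⁻¹ • h')], hK.le_one _⟩
  have hdec : lagWeight K t Δ θ h' - lagWeight K t Δ θ h =
      (character h' θ - character h θ) * ((k' * (1 / o') : ℝ) : ℂ)
        + character h θ * (((k' - k) * (1 / o') : ℝ) : ℂ)
        + character h θ * ((k * ((o - o') * (1 / o) * (1 / o')) : ℝ) : ℂ) := by
    have e : k * ((o - o') * (1 / o) * (1 / o')) = k * (1 / o') - k * (1 / o) := by
      field_simp
    rw [lagWeight, lagWeight, ← hk, ← hk', ← ho, ← ho', e, div_eq_mul_one_div k',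
      div_eq_mul_one_div k]
    push_cast
    ring
  have b1 : ‖(character h' θ - character h θ) * ((k' * (1 / o') : ℝ) : ℂ)‖ ≤
      (τ * (2 * δ)) * (1 * (2 / v)) := by
    rw [norm_mul, Complex.norm_real, Real.norm_eq_abs, abs_mul, abs_of_pos (one_div_pos.2 hopos')]
    gcongr
    exact (norm_character_sub_le h h' θ).trans (by gcongr)
  have b2 : ‖character h θ * (((k' - k) * (1 / o') : ℝ) : ℂ)‖ ≤ (L * (2 * δ)) * (2 / v) := by
    rw [norm_mul, norm_character, one_mul, Complex.norm_real, Real.norm_eq_abs, abs_mul,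
      abs_of_pos (one_div_pos.2 hopos')]
    gcongr
    have h1 := hL.dist_le_mul (Δ⁻¹ • h') (Δ⁻¹ • h)
    rw [Real.dist_eq, dist_eq_norm, ← smul_sub, norm_smul, norm_inv,
      Real.norm_of_nonneg hΔ0.le] at h1
    refine h1.trans ?_
    refine mul_le_mul_of_nonneg_left ?_ L.2
    calc Δ⁻¹ * ‖h' - h‖ ≤ 1 * ‖h' - h‖ := by
          gcongr
          exact inv_le_one_of_one_le₀ hΔ
      _ ≤ 2 * δ := by rwa [one_mul]
  have b3 : ‖character h θ * ((k * ((o - o') * (1 / o) * (1 / o')) : ℝ) : ℂ)‖ ≤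
      1 * ((d * (2 * δ) * v) * (2 / v) * (2 / v)) := by
    rw [norm_mul, norm_character, one_mul, Complex.norm_real, Real.norm_eq_abs, abs_mul, abs_mul,
      abs_mul, abs_of_pos (one_div_pos.2 hopos'), abs_of_pos (one_div_pos.2 hopos)]
    gcongr
    refine (abs_overlapVol_sub_le hρ0 hball h h').trans ?_
    rw [norm_sub_rev]
    gcongr
    exact (div_le_self (norm_nonneg _) hρ).trans hhh
  rw [hdec]
  refine (norm_add₃_le.trans (add_le_add (add_le_add b1 b2) b3)).trans (le_of_eq ?_)
  field_simp
  ring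

end Kernel

/-! ### Variance of weighted sums of cross products. -/

section Bounds

variable {d n : ℕ} {ι H Ω : Type*} [NormedAddCommGroup H] [InnerProductSpace ℂ H]
  [MeasurableSpace Ω] {b : HilbertBasis ι ℂ H} {P : Measure Ω}
  {X : EuclideanSpace ℝ (Fin d) → Ω → H}

theorem IsSecondOrderStationary.covOp_eq (hX : IsSecondOrderStationary b P X)
    (s u : EuclideanSpace ℝ (Fin d)) : covOp P (X s) (X u) = stationaryCov P X (s - u) := by
  have := hX.cov_shift (s - u) 0 u
  rwa [sub_add_cancel, zero_add] at this

theorem CumulantAssumption.cum_eq (hV : CumulantAssumption b P X)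
    (s u w v : EuclideanSpace ℝ (Fin d)) :
    cum b P (X s) (X u) (X w) (X v) = cum b P (X (s - v)) (X (u - v)) (X (w - v)) (X 0) := by
  have := hV.stationary (s - v) (u - v) (w - v) 0 v
  simpa using this

variable [CompleteSpace H]

theorem CovarianceAssumption.exists_lintegral_traceOsc_le {γ : ℝ}
    (hC : CovarianceAssumption b P X γ) :
    ∃ M : ℝ≥0, ∃ δ₀ > (0 : ℝ), ∀ δ : ℝ, 0 ≤ δ → δ ≤ δ₀ →
      ∫⁻ x, traceOsc b (stationaryCov P X) δ x ≤ M * ENNReal.ofReal (δ ^ γ) := by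
  obtain ⟨M, δ₀, hδ₀, h⟩ := hC.holder
  refine ⟨M, δ₀, hδ₀, fun δ hδ hle => ?_⟩
  -- The tessellation diameter is only known to be non-negative; at scale zero the oscillation
  -- vanishes.
  rcases hδ.eq_or_lt with rfl | hpos
  · simp [traceOsc, traceNorm, CFC.abs_zero]
  · exact h δ hpos hle

theorem CovarianceAssumption.lintegral_hsTraceNorm_lt_top {γ : ℝ}
    (hC : CovarianceAssumption b P X γ) : ∫⁻ h, hsTraceNorm b (stationaryCov P X h) < ∞ := by
  refine (lintegral_mono fun h => hsTraceNorm_le b _).trans_lt ?_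
  rw [lintegral_const_mul' _ _ (by simp)]
  exact ENNReal.mul_lt_top (by simp) hC.integrable

theorem CovarianceAssumption.integrable_stationaryCov {γ : ℝ}
    (hC : CovarianceAssumption b P X γ) : Integrable (stationaryCov P X) :=
  ⟨hC.aestronglyMeasurable,
    (lintegral_mono fun _ => enorm_le_traceNorm b _).trans_lt hC.integrable⟩

/-- The constant bounding the integrals of the cumulants at scale `δ`. -/
def cumBound (b : HilbertBasis ι ℂ H) (P : Measure Ω) (X : EuclideanSpace ℝ (Fin d) → Ω → H)
    (δ : ℝ) : ℝ≥0∞ :=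
  ⨆ w, ∫⁻ u, ∫⁻ v, ⨆ l₁ ∈ Metric.ball (0 : EuclideanSpace ℝ (Fin d)) δ,
      ⨆ l₂ ∈ Metric.ball (0 : EuclideanSpace ℝ (Fin d)) δ,
      ⨆ l₃ ∈ Metric.ball (0 : EuclideanSpace ℝ (Fin d)) δ,
        ‖cum b P (X (l₁ + u)) (X (l₂ + v)) (X (l₃ + w)) (X 0)‖ₑ

theorem lintegral_hsNorm_weighted_sum_sq_le [Countable ι] [IsProbabilityMeasure P]
    (hX : IsSecondOrderStationary b P X) (hreal : IsRealProcess b P X)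
    (hV : CumulantAssumption b P X)
    (hC : AEStronglyMeasurable (stationaryCov P X) volume)
    {t : Fin n → EuclideanSpace ℝ (Fin d)} (ht : Function.Injective t)
    {δ : ℝ} (hδ : tessDiam t < δ) (w : Fin n → Fin n → ℂ) {m : ℝ≥0∞} {r : ℝ}
    (hw : ∀ i j, ‖w i j‖ₑ ≤ m * (volume (cell t i) * volume (cell t j) *
      (Metric.closedBall (0 : EuclideanSpace ℝ (Fin d)) r).indicator 1 (t i - t j))) :
    ∫⁻ ω, hsNorm b (∑ i, ∑ j, w i j •
        (outer (X (t i) ω) (X (t j) ω) - stationaryCov P X (t i - t j))) ^ 2 ∂P ≤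
      m ^ 2 * (volume (region t) *
        volume (Metric.closedBall (0 : EuclideanSpace ℝ (Fin d)) (r + tessDiam t)) *
        (cumBound b P X δ + 2 * ((∫⁻ h, hsTraceNorm b (stationaryCov P X h))
          + 2 * ∫⁻ h, traceOsc b (stationaryCov P X) (tessDiam t) h) ^ 2)) := by
  set C := stationaryCov P X with hCdef
  set V : Fin n → ℝ≥0∞ := fun i => volume (cell t i) with hVdef
  set χ : Fin n → Fin n → ℝ≥0∞ := fun i j =>
    (Metric.closedBall (0 : EuclideanSpace ℝ (Fin d)) r).indicator 1 (t i - t j) with hχdef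
  set a : Fin n → Fin n → ℝ≥0∞ := fun i j => hsTraceNorm b (C (t i - t j)) with hadef
  set c : Fin n → Fin n → Fin n → Fin n → ℝ≥0∞ := fun i j k l =>
    ‖cum b P (X (t i)) (X (t j)) (X (t k)) (X (t l))‖ₑ with hcdef
  have h1 := lintegral_hsNorm_sum_sub_covOp_sq_le (P := P) b
    (fun p : Fin n × Fin n => w p.1 p.2) (Y := fun p => X (t p.1)) (Z := fun p => X (t p.2))
    (fun p => hV.memLp _) (fun p => hV.memLp _)
  simp only [Fintype.sum_prod_type, hX.covOp_eq] at h1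
  refine h1.trans ?_
  have hcov : ∀ i j k l, ‖outerCov b P (X (t i)) (X (t j)) (X (t k)) (X (t l))‖ₑ ≤
      c i j k l + a k i * a j l + a i l * a k j := by
    intro i j k l
    have := enorm_outerCov_le b (hX.memLp (t i)) (hX.memLp (t j)) (hX.memLp (t k))
      (hX.memLp (t l)) (hreal (t j)) (hreal (t l))
    simpa only [hX.covOp_eq] using this
  calc ∑ i, ∑ j, ∑ k, ∑ l, ‖w i j‖ₑ * ‖w k l‖ₑ *
        ‖outerCov b P (X (t i)) (X (t j)) (X (t k)) (X (t l))‖ₑ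
      ≤ ∑ i, ∑ j, ∑ k, ∑ l, m ^ 2 * ((V i * V j * χ i j) * (V k * V l * χ k l) *
          (c i j k l + a k i * a j l + a i l * a k j)) := by
        refine Finset.sum_le_sum fun i _ => Finset.sum_le_sum fun j _ =>
          Finset.sum_le_sum fun k _ => Finset.sum_le_sum fun l _ => ?_
        refine (mul_le_mul' (mul_le_mul' (hw i j) (hw k l)) (hcov i j k l)).trans (le_of_eq ?_)
        ring
    _ = m ^ 2 * ∑ i, ∑ j, ∑ k, ∑ l, (V i * V j * χ i j) * (V k * V l * χ k l) *
          (c i j k l + a k i * a j l + a i l * a k j) := by simp_rw [Finset.mul_sum]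
    _ ≤ _ := by
        gcongr
        refine sum_four_le (fun i j => ?_) (fun k l => ?_) (fun i => ?_) (fun i => ?_) ?_
        · exact Set.indicator_le_self' (fun _ _ => zero_le) _
        -- Shifting all four arguments by t_l puts the origin in the last slot, with third argument
        -- t_k - t_l, over which the cumulant bound is uniform.
        · have h2 := sum_volume_cell_mul_sum_le_lintegral_iSup ht
            (fun u v w => ‖cum b P (X u) (X v) (X w) (X 0)‖ₑ) hδ (t l) (t k - t l)
          simp only [hcdef, hV.cum_eq _ _ _ (t l)]
          exact h2.trans (le_iSup_of_le (t k - t l) le_rfl)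
        · exact sum_volume_cell_mul_hsTraceNorm_sub_right_le ht b hC (t i)
        · exact sum_volume_cell_mul_hsTraceNorm_sub_left_le ht b hC (t i)
        · exact sum_volume_cell_mul_indicator_le ht r

end Bounds

/-! ### Splitting the error. -/

section Decomposition

theorem estimator_eq {d n : ℕ} {H Ω : Type*} [NormedAddCommGroup H] [InnerProductSpace ℂ H]
    (X : EuclideanSpace ℝ (Fin d) → Ω → H) (K : EuclideanSpace ℝ (Fin d) → ℝ)
    (t : Fin n → EuclideanSpace ℝ (Fin d)) (Δ : ℝ)
    (θ : EuclideanSpace ℝ (Fin d)) (ω : Ω) :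
    estimator X K t Δ θ ω = (((2 * Real.pi) ^ d : ℝ)⁻¹ : ℂ) • ∑ i, ∑ j,
      (lagWeight K t Δ θ (t i - t j) *
        (volume.real (cell t i) * volume.real (cell t j) : ℝ)) • outer (X (t i) ω) (X (t j) ω) := by
  rw [estimator]
  congr 1
  refine Finset.sum_congr rfl fun i _ => Finset.sum_congr rfl fun j _ => ?_
  rw [lagWeight]
  congr 1
  push_cast
  ring

variable {d n : ℕ} {ι H Ω : Type*} [NormedAddCommGroup H] [InnerProductSpace ℂ H]
  [CompleteSpace H] [MeasurableSpace Ω] {b : HilbertBasis ι ℂ H} {P : Measure Ω}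
  {X : EuclideanSpace ℝ (Fin d) → Ω → H} {K : EuclideanSpace ℝ (Fin d) → ℝ}

theorem integrable_smul_of_norm_le_one {C : EuclideanSpace ℝ (Fin d) → H →L[ℂ] H}
    (hC : Integrable C) {q : EuclideanSpace ℝ (Fin d) → ℂ} (hq : Continuous q)
    (hq1 : ∀ h, ‖q h‖ ≤ 1) : Integrable fun h => q h • C h := by
  refine hC.mono (hq.aestronglyMeasurable.smul hC.1) (Eventually.of_forall fun h => ?_)
  rw [norm_smul]
  exact mul_le_of_le_one_left (norm_nonneg _) (hq1 h)

/-- On the scaled support write 1 = K + (1 - K); off it K vanishes, so the K-weighted integral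
extends to the whole space. -/
theorem integral_character_smul_eq {C : EuclideanSpace ℝ (Fin d) → H →L[ℂ] H}
    (hC : Integrable C) (hK : KernelAssumption K) {Δ : ℝ} (hΔ : 0 < Δ)
    (θ : EuclideanSpace ℝ (Fin d)) :
    ∫ h, character h θ • C h = (∫ h, (character h θ * (K (Δ⁻¹ • h) : ℂ)) • C h)
      + (∫ h in Δ • kernelSupp K, (character h θ * ((1 - K (Δ⁻¹ • h) : ℝ) : ℂ)) • C h)
      + ∫ h in (Δ • kernelSupp K)ᶜ, character h θ • C h := by
  have hKc := hK.continuous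
  have hcont : Continuous fun h : EuclideanSpace ℝ (Fin d) => K (Δ⁻¹ • h) := by fun_prop
  have hchar := continuous_character θ
  have hmem : ∀ h, h ∈ Δ • kernelSupp K ↔ 0 < K (Δ⁻¹ • h) := fun h =>
    Set.mem_smul_set_iff_inv_smul_mem₀ hΔ.ne' _ _
  have hA : MeasurableSet (Δ • kernelSupp K) := by
    have : Δ • kernelSupp K = {h | 0 < K (Δ⁻¹ • h)} := Set.ext hmem
    rw [this]
    exact (isOpen_lt continuous_const hcont).measurableSet
  have hK1 : ∀ u, |K u| ≤ 1 := fun u => abs_le.2 ⟨by linarith [hK.nonneg u], hK.le_one u⟩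
  have i1 : Integrable fun h => character h θ • C h :=
    integrable_smul_of_norm_le_one hC hchar fun h => (norm_character h θ).le
  have i2 : Integrable fun h => (character h θ * (K (Δ⁻¹ • h) : ℂ)) • C h := by
    refine integrable_smul_of_norm_le_one hC (by fun_prop) fun h => ?_
    rw [norm_mul, norm_character, one_mul, Complex.norm_real]
    exact hK1 _
  have i3 : Integrable fun h => (character h θ * ((1 - K (Δ⁻¹ • h) : ℝ) : ℂ)) • C h := by
    refine integrable_smul_of_norm_le_one hC (by fun_prop) fun h => ?_
    rw [norm_mul, norm_character, one_mul, Complex.norm_real, Real.norm_eq_abs, abs_le]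
    constructor <;> linarith [hK.nonneg (Δ⁻¹ • h), hK.le_one (Δ⁻¹ • h)]
  rw [← integral_add_compl hA i1]
  congr 1
  rw [← setIntegral_eq_integral_of_forall_compl_eq_zero (s := Δ • kernelSupp K)
    (f := fun h => (character h θ * (K (Δ⁻¹ • h) : ℂ)) • C h),
    ← integral_add i2.integrableOn i3.integrableOn]
  · refine integral_congr_ae (Eventually.of_forall fun h => ?_)
    simp only [← add_smul, ← mul_add]
    congr 1
    push_cast
    ring
  · intro h hh
    rw [hmem, not_lt] at hh
    simp [le_antisymm hh (hK.nonneg _)]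

/-- The mean of the (unnormalised) estimator minus the kernel-weighted integral that it
approximates. -/
def samplingBias (P : Measure Ω) (X : EuclideanSpace ℝ (Fin d) → Ω → H)
    (K : EuclideanSpace ℝ (Fin d) → ℝ) (t : Fin n → EuclideanSpace ℝ (Fin d)) (Δ : ℝ)
    (θ : EuclideanSpace ℝ (Fin d)) : H →L[ℂ] H :=
  ∑ i, ∑ j, (lagWeight K t Δ θ (t i - t j) *
      (volume.real (cell t i) * volume.real (cell t j) : ℝ)) • stationaryCov P X (t i - t j)
    - ∫ h, (character h θ * (K (Δ⁻¹ • h) : ℂ)) • stationaryCov P X h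

/-- The fluctuation of the (unnormalised) estimator about its mean. -/
def fluctuation (P : Measure Ω) (X : EuclideanSpace ℝ (Fin d) → Ω → H)
    (K : EuclideanSpace ℝ (Fin d) → ℝ) (t : Fin n → EuclideanSpace ℝ (Fin d)) (Δ : ℝ)
    (θ : EuclideanSpace ℝ (Fin d)) (ω : Ω) : H →L[ℂ] H :=
  ∑ i, ∑ j, (lagWeight K t Δ θ (t i - t j) *
      (volume.real (cell t i) * volume.real (cell t j) : ℝ)) •
    (outer (X (t i) ω) (X (t j) ω) - stationaryCov P X (t i - t j))

theorem hsNorm_estimator_sub_spectralDensity_le (hC : Integrable (stationaryCov P X))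
    (hK : KernelAssumption K) (t : Fin n → EuclideanSpace ℝ (Fin d)) {Δ : ℝ} (hΔ : 0 < Δ)
    (θ : EuclideanSpace ℝ (Fin d)) (ω : Ω) :
    hsNorm b (estimator X K t Δ θ ω - spectralDensity P X θ) ≤
      ‖(((2 * Real.pi) ^ d : ℝ)⁻¹ : ℂ)‖ₑ * (hsNorm b (fluctuation P X K t Δ θ ω)
        + (hsNorm b (samplingBias P X K t Δ θ) + biasKernel b P X K Δ θ
          + biasTail b P X K Δ θ)) := by
  have h : estimator X K t Δ θ ω - spectralDensity P X θ = (((2 * Real.pi) ^ d : ℝ)⁻¹ : ℂ) •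
      (fluctuation P X K t Δ θ ω + (samplingBias P X K t Δ θ
        - (∫ h in Δ • kernelSupp K,
            (character h θ * ((1 - K (Δ⁻¹ • h) : ℝ) : ℂ)) • stationaryCov P X h)
        - ∫ h in (Δ • kernelSupp K)ᶜ, character h θ • stationaryCov P X h)) := by
    rw [estimator_eq, spectralDensity, integral_character_smul_eq hC hK hΔ θ, ← smul_sub,
      fluctuation, samplingBias]
    congr 1
    simp_rw [smul_sub, Finset.sum_sub_distrib]
    abel
  rw [h, hsNorm_smul]
  gcongr
  refine (hsNorm_add_le b _ _).trans (add_le_add le_rfl ?_)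
  exact (hsNorm_sub_le b _ _).trans (add_le_add (hsNorm_sub_le b _ _) le_rfl)

/-- Minkowski's inequality in L²(P); the deterministic terms form a constant whose L² norm is itself
because P is a probability. -/
theorem rootMSE_le [Countable ι] [IsProbabilityMeasure P] (hX : ∀ s, MemLp (X s) 2 P)
    (hC : Integrable (stationaryCov P X))
    (hK : KernelAssumption K) (t : Fin n → EuclideanSpace ℝ (Fin d)) {Δ : ℝ} (hΔ : 0 < Δ)
    (θ : EuclideanSpace ℝ (Fin d)) :
    rootMSE b P X K t Δ θ ≤ ‖(((2 * Real.pi) ^ d : ℝ)⁻¹ : ℂ)‖ₑ *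
      ((∫⁻ ω, hsNorm b (fluctuation P X K t Δ θ ω) ^ 2 ∂P) ^ (1 / 2 : ℝ)
        + (hsNorm b (samplingBias P X K t Δ θ) + biasKernel b P X K Δ θ
          + biasTail b P X K Δ θ)) := by
  set c : ℝ≥0∞ := ‖(((2 * Real.pi) ^ d : ℝ)⁻¹ : ℂ)‖ₑ with hc
  set β := hsNorm b (samplingBias P X K t Δ θ) + biasKernel b P X K Δ θ + biasTail b P X K Δ θ
  have hcfin : c ≠ ∞ := enorm_ne_top
  have hmeas : AEMeasurable (fun ω => hsNorm b (fluctuation P X K t Δ θ ω)) P := by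
    refine aemeasurable_hsNorm b ?_
    unfold fluctuation
    refine Finset.aestronglyMeasurable_fun_sum _ fun i _ =>
      Finset.aestronglyMeasurable_fun_sum _ fun j _ => ?_
    exact ((aestronglyMeasurable_outer (hX (t i)).1 (hX (t j)).1).sub
      aestronglyMeasurable_const).const_smul (lagWeight K t Δ θ (t i - t j) *
        (volume.real (cell t i) * volume.real (cell t j) : ℝ) : ℂ)
  have hmink := ENNReal.lintegral_Lp_add_le (μ := P) (p := 2) hmeas
    (aemeasurable_const (b := β)) one_le_two
  simp only [Pi.add_apply, lintegral_const, measure_univ, mul_one] at hmink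
  have hβ : (β ^ (2 : ℝ)) ^ (1 / 2 : ℝ) = β := by
    rw [← ENNReal.rpow_mul]
    norm_num
  rw [hβ] at hmink
  calc rootMSE b P X K t Δ θ
      ≤ (∫⁻ ω, c ^ 2 * (hsNorm b (fluctuation P X K t Δ θ ω) + β) ^ 2 ∂P) ^ (1 / 2 : ℝ) := by
        rw [rootMSE]
        gcongr with ω
        rw [← mul_pow]
        gcongr
        exact hsNorm_estimator_sub_spectralDensity_le hC hK t hΔ θ ω
    _ = c * (∫⁻ ω, (hsNorm b (fluctuation P X K t Δ θ ω) + β) ^ 2 ∂P) ^ (1 / 2 : ℝ) := by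
        rw [lintegral_const_mul' _ _ (by finiteness), ENNReal.mul_rpow_of_nonneg _ _ (by norm_num),
          ← ENNReal.rpow_natCast, ← ENNReal.rpow_mul]
        norm_num
    _ ≤ _ := by
        gcongr
        simpa only [ENNReal.rpow_ofNat] using hmink

end Decomposition

/-! ### Rates for the sampling bias and the fluctuation. -/

section Rates

variable {d n : ℕ} {ι H Ω : Type*} [Countable ι] [NormedAddCommGroup H] [InnerProductSpace ℂ H]
  [CompleteSpace H] [MeasurableSpace Ω] {b : HilbertBasis ι ℂ H} {P : Measure Ω}
  {X : EuclideanSpace ℝ (Fin d) → Ω → H} {K : EuclideanSpace ℝ (Fin d) → ℝ}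
  {t : Fin n → EuclideanSpace ℝ (Fin d)} {Δ R ρ γ : ℝ} {x₀ : EuclideanSpace ℝ (Fin d)}

theorem ofReal_regionVol (t : Fin n → EuclideanSpace ℝ (Fin d)) :
    ENNReal.ofReal (regionVol t) = volume (region t) :=
  ENNReal.ofReal_toReal (isCompact_region t).measure_lt_top.ne

theorem hsNorm_samplingBias_le (hC : CovarianceAssumption b P X γ) (hK : KernelAssumption K)
    {L : ℝ≥0} (hL : LipschitzWith L K) (ht : Function.Injective t)
    (hΔ : 1 ≤ Δ) (hR : ∀ u, K u ≠ 0 → ‖u‖ ≤ R) (hρ : 1 ≤ ρ)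
    (hball : Metric.closedBall x₀ ρ ⊆ region t) (hRρ : 2 * d * (R * Δ + 2) ≤ ρ)
    (hvol : 0 < regionVol t) (hδ : tessDiam t ≤ 1) {M : ℝ≥0}
    (hM : ∫⁻ x, traceOsc b (stationaryCov P X) (2 * tessDiam t) x ≤
      M * ENNReal.ofReal ((2 * tessDiam t) ^ γ))
    {θ : EuclideanSpace ℝ (Fin d)} {τ : ℝ} (hτ : ‖θ‖ ≤ τ) :
    hsNorm b (samplingBias P X K t Δ θ) ≤
      (ENNReal.ofReal (4 * τ + 4 * L + 8 * d) * (∫⁻ h, hsTraceNorm b (stationaryCov P X h))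
        + 4 * M) * ENNReal.ofReal (tessDiam t ^ γ) := by
  have hΔ0 : 0 < Δ := by linarith
  have hρ0 : 0 < ρ := by linarith
  have hδ0 := tessDiam_nonneg t
  have hτ0 : 0 ≤ τ := (norm_nonneg θ).trans hτ
  have hRρ' : 2 * d * (R * Δ) ≤ ρ :=
    (mul_le_mul_of_nonneg_left (by linarith) (by positivity)).trans hRρ
  have hCi := hC.integrable_stationaryCov
  have hov := fun h => lagWeight_mul_overlapVol hΔ0 hR hρ0 hball hRρ' hvol θ h
  have hint : Integrable fun h =>
      (lagWeight K t Δ θ h * (overlapVol t h : ℂ)) • stationaryCov P X h := by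
    simp_rw [hov]
    have hKc := hK.continuous
    have hch := continuous_character θ
    refine integrable_smul_of_norm_le_one hCi (by fun_prop) fun h => ?_
    rw [norm_mul, norm_character, one_mul, Complex.norm_real, Real.norm_of_nonneg (hK.nonneg _)]
    exact hK.le_one _
  have key := hsNorm_sum_sub_integral_le ht b hC.aestronglyMeasurable
    (measurable_lagWeight hK.continuous θ) hint (m := ENNReal.ofReal (2 / regionVol t))
    (κ := ENNReal.ofReal ((4 * τ + 4 * L + 8 * d) * tessDiam t / regionVol t))
    ENNReal.ofReal_ne_top
    (fun h => by
      rw [← ofReal_norm]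
      exact ENNReal.ofReal_le_ofReal (norm_lagWeight_le hK hΔ0 hR hρ0 hball hRρ' hvol θ h))
    (fun h h' hh => by
      rw [← ofReal_norm]
      exact ENNReal.ofReal_le_ofReal
        (norm_lagWeight_sub_le hK hL hΔ hR hρ hball hRρ hvol hδ hτ hh))
  simp_rw [hov] at key
  refine key.trans ?_
  rw [← ofReal_regionVol, mul_add, ← mul_assoc, ← mul_assoc, ← ENNReal.ofReal_mul hvol.le,
    ← ENNReal.ofReal_mul hvol.le, mul_div_cancel₀ _ hvol.ne', mul_div_cancel₀ _ hvol.ne',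
    add_mul _ (4 * (M : ℝ≥0∞))]
  -- As the diameter and γ are at most 1, the linear error of the weights is absorbed into the
  -- Hölder rate.
  have hδγ : tessDiam t ≤ tessDiam t ^ γ := by
    simpa using Real.rpow_le_rpow_of_exponent_ge' hδ0 hδ hC.gamma_pos.le hC.gamma_le_one
  -- Together with the weight bound 2/|T| this factor 2 yields the constant 4M.
  have h2γ : (2 * tessDiam t) ^ γ ≤ 2 * tessDiam t ^ γ := by
    rw [Real.mul_rpow zero_le_two hδ0]
    gcongr
    simpa using Real.rpow_le_rpow_of_exponent_le (one_le_two (α := ℝ)) hC.gamma_le_one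
  refine add_le_add ?_ ?_
  · rw [ENNReal.ofReal_mul (by positivity), mul_right_comm]
    gcongr
    exact hsNorm_le_hsTraceNorm b _
  · calc ENNReal.ofReal 2 * ∫⁻ h, traceOsc b (stationaryCov P X) (2 * tessDiam t) h
        ≤ ENNReal.ofReal 2 * (M * ENNReal.ofReal (2 * tessDiam t ^ γ)) := by
          gcongr
          exact hM.trans (by gcongr)
      _ = 4 * M * ENNReal.ofReal (tessDiam t ^ γ) := by
          rw [ENNReal.ofReal_mul zero_le_two, ENNReal.ofReal_ofNat]
          ring

theorem lintegral_hsNorm_fluctuation_sq_le [IsProbabilityMeasure P]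
    (hX : IsSecondOrderStationary b P X)
    (hreal : IsRealProcess b P X) (hV : CumulantAssumption b P X)
    (hC : CovarianceAssumption b P X γ) (hK : KernelAssumption K) (ht : Function.Injective t)
    (hΔ : 1 ≤ Δ) (hR0 : 0 ≤ R) (hR : ∀ u, K u ≠ 0 → ‖u‖ ≤ R) (hρ : 0 < ρ)
    (hball : Metric.closedBall x₀ ρ ⊆ region t) (hRρ : 2 * d * (R * Δ) ≤ ρ)
    (hvol : 0 < regionVol t) (hδ1 : tessDiam t ≤ 1) {M : ℝ≥0}
    (hM : ∫⁻ x, traceOsc b (stationaryCov P X) (tessDiam t) x ≤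
      M * ENNReal.ofReal (tessDiam t ^ γ))
    {δ : ℝ} (hδ : tessDiam t < δ) (θ : EuclideanSpace ℝ (Fin d)) :
    ∫⁻ ω, hsNorm b (fluctuation P X K t Δ θ ω) ^ 2 ∂P ≤
      ENNReal.ofReal (4 * (R + 1) ^ d) * volume (Metric.ball (0 : EuclideanSpace ℝ (Fin d)) 1) *
        (cumBound b P X δ + 2 * ((∫⁻ h, hsTraceNorm b (stationaryCov P X h)) + 2 * M) ^ 2) *
        ENNReal.ofReal (Δ ^ d / regionVol t) := by
  have hΔ0 : 0 < Δ := by linarith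
  have hδ0 := tessDiam_nonneg t
  have hw : ∀ i j, ‖lagWeight K t Δ θ (t i - t j) *
      (volume.real (cell t i) * volume.real (cell t j) : ℝ)‖ₑ ≤
      ENNReal.ofReal (2 / regionVol t) * (volume (cell t i) * volume (cell t j) *
        (Metric.closedBall (0 : EuclideanSpace ℝ (Fin d)) (R * Δ)).indicator 1 (t i - t j)) := by
    intro i j
    by_cases h0 : K (Δ⁻¹ • (t i - t j)) = 0
    · simp [lagWeight, h0]
    have hmem : t i - t j ∈ Metric.closedBall (0 : EuclideanSpace ℝ (Fin d)) (R * Δ) := by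
      rw [mem_closedBall_zero_iff]
      exact norm_le_of_kernel_ne_zero hΔ0 hR h0
    rw [Set.indicator_of_mem hmem, Pi.one_apply, mul_one, enorm_mul]
    refine mul_le_mul' ?_ (le_of_eq ?_)
    · rw [← ofReal_norm]
      exact ENNReal.ofReal_le_ofReal (norm_lagWeight_le hK hΔ0 hR hρ hball hRρ hvol θ _)
    · rw [← ofReal_norm, Complex.norm_real, Real.norm_of_nonneg (by positivity),
        ENNReal.ofReal_mul measureReal_nonneg, ofReal_measureReal (volume_cell_lt_top t i).ne,
        ofReal_measureReal (volume_cell_lt_top t j).ne]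
  refine (lintegral_hsNorm_weighted_sum_sq_le hX hreal hV hC.aestronglyMeasurable ht hδ _
    hw).trans ?_
  have hMle : (M : ℝ≥0∞) * ENNReal.ofReal (tessDiam t ^ γ) ≤ M := by
    refine mul_le_of_le_one_right zero_le ?_
    rw [ENNReal.ofReal_le_one]
    exact Real.rpow_le_one hδ0 hδ1 hC.gamma_pos.le
  -- Since Δ ≥ 1 and the diameter is at most 1, the radius is at most (R + 1)Δ.
  have hballvol : volume (Metric.closedBall (0 : EuclideanSpace ℝ (Fin d)) (R * Δ + tessDiam t)) ≤
      ENNReal.ofReal ((R + 1) ^ d * Δ ^ d) *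
        volume (Metric.ball (0 : EuclideanSpace ℝ (Fin d)) 1) := by
    rw [Measure.addHaar_closedBall _ _ (by positivity), finrank_euclideanSpace_fin, ← mul_pow]
    gcongr
    nlinarith
  calc ENNReal.ofReal (2 / regionVol t) ^ 2 * (volume (region t) *
        volume (Metric.closedBall (0 : EuclideanSpace ℝ (Fin d)) (R * Δ + tessDiam t)) *
        (cumBound b P X δ + 2 * ((∫⁻ h, hsTraceNorm b (stationaryCov P X h))
          + 2 * ∫⁻ h, traceOsc b (stationaryCov P X) (tessDiam t) h) ^ 2))
      ≤ ENNReal.ofReal (2 / regionVol t) ^ 2 * (ENNReal.ofReal (regionVol t) *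
        (ENNReal.ofReal ((R + 1) ^ d * Δ ^ d) *
          volume (Metric.ball (0 : EuclideanSpace ℝ (Fin d)) 1)) *
        (cumBound b P X δ + 2 * ((∫⁻ h, hsTraceNorm b (stationaryCov P X h)) + 2 * M) ^ 2)) := by
        rw [ofReal_regionVol]
        gcongr
        exact hM.trans hMle
    _ = (ENNReal.ofReal (2 / regionVol t) ^ 2 * ENNReal.ofReal (regionVol t) *
          ENNReal.ofReal ((R + 1) ^ d * Δ ^ d)) *
          volume (Metric.ball (0 : EuclideanSpace ℝ (Fin d)) 1) *
        (cumBound b P X δ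
          + 2 * ((∫⁻ h, hsTraceNorm b (stationaryCov P X h)) + 2 * M) ^ 2) := by ring
    _ = (ENNReal.ofReal (4 * (R + 1) ^ d) * ENNReal.ofReal (Δ ^ d / regionVol t)) *
          volume (Metric.ball (0 : EuclideanSpace ℝ (Fin d)) 1) *
        (cumBound b P X δ
          + 2 * ((∫⁻ h, hsTraceNorm b (stationaryCov P X h)) + 2 * M) ^ 2) := by
        congr 2
        rw [← ENNReal.ofReal_pow (by positivity), ← ENNReal.ofReal_mul (by positivity),
          ← ENNReal.ofReal_mul (by positivity), ← ENNReal.ofReal_mul (by positivity)]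
        congr 1
        field_simp
        ring
    _ = _ := by ring

end Rates

end SpectralDensity

end

/-! ### Assembly of the bound. -/

theorem mainTheorem4 {d : ℕ} {ι H Ω : Type*}
    [NormedAddCommGroup H] [InnerProductSpace ℂ H] [CompleteSpace H]
    [TopologicalSpace.SeparableSpace H] (b : HilbertBasis ι ℂ H)
    [MeasurableSpace Ω] (P : Measure Ω) [IsProbabilityMeasure P]
    (X : EuclideanSpace ℝ (Fin d) → Ω → H)
    (hX : SpectralDensity.IsSecondOrderStationary b P X)
    (hreal : SpectralDensity.IsRealProcess b P X)
    (γ : ℝ) (hC : SpectralDensity.CovarianceAssumption b P X γ)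
    (K : EuclideanSpace ℝ (Fin d) → ℝ) (hK : SpectralDensity.KernelAssumption K)
    (t : (n : ℕ) → Fin n → EuclideanSpace ℝ (Fin d))
    (hS : SpectralDensity.SamplingAssumption t)
    (hV : SpectralDensity.CumulantAssumption b P X)
    (Δ : ℕ → ℝ) (hΔpos : ∀ n, 0 < Δ n) (hΔ : Tendsto Δ atTop atTop)
    (hΔsupp : ∀ᶠ n in atTop, Δ n • SpectralDensity.kernelSupp K ⊆
      SpectralDensity.region (t n) - SpectralDensity.region (t n))
    (hΔvol : Tendsto (fun n => Δ n ^ d / SpectralDensity.regionVol (t n)) atTop (𝓝 0))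
    (Θ : Set (EuclideanSpace ℝ (Fin d))) (hΘ : Bornology.IsBounded Θ) :
    ∃ M : ℝ≥0, ∀ᶠ n in atTop, ∀ θ ∈ Θ,
      SpectralDensity.rootMSE b P X K (t n) (Δ n) θ ≤
        M * (ENNReal.ofReal (SpectralDensity.tessDiam (t n) ^ γ)
          + SpectralDensity.biasKernel b P X K (Δ n) θ
          + SpectralDensity.biasTail b P X K (Δ n) θ
          + ENNReal.ofReal (Real.sqrt (Δ n ^ d / SpectralDensity.regionVol (t n)))) := by
  have : Countable ι := b.countable
  obtain ⟨R, hR0, hR⟩ := hK.exists_norm_le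
  obtain ⟨L, hL⟩ := hK.lipschitz
  obtain ⟨τ, hτ⟩ := hΘ.exists_norm_le
  obtain ⟨M, δ₀, hδ₀, hM⟩ := hC.exists_lintegral_traceOsc_le
  obtain ⟨δ, hδ, hcum⟩ := hV.integrable
  set I := ∫⁻ h, SpectralDensity.hsTraceNorm b (SpectralDensity.stationaryCov P X h) with hI
  have hIfin : I < ∞ := hC.lintegral_hsTraceNorm_lt_top
  have hBfin : SpectralDensity.cumBound b P X δ < ∞ := hcum
  set c₀ : ℝ≥0∞ := ‖(((2 * Real.pi) ^ d : ℝ)⁻¹ : ℂ)‖ₑ with hc₀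
  set c₁ : ℝ≥0∞ := ENNReal.ofReal (4 * τ + 4 * L + 8 * d) * I + 4 * M with hc₁
  set c₂ : ℝ≥0∞ := ENNReal.ofReal (4 * (R + 1) ^ d) *
    volume (Metric.ball (0 : EuclideanSpace ℝ (Fin d)) 1) *
      (SpectralDensity.cumBound b P X δ + 2 * (I + 2 * M) ^ 2) with hc₂
  have hc₀fin : c₀ ≠ ∞ := enorm_ne_top
  have hc₁fin : c₁ ≠ ∞ := by finiteness
  have hc₂fin : c₂ ≠ ∞ := by
    have : volume (Metric.ball (0 : EuclideanSpace ℝ (Fin d)) 1) ≠ ∞ := measure_ball_lt_top.ne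
    exact ENNReal.mul_ne_top (ENNReal.mul_ne_top ENNReal.ofReal_ne_top this)
      (ENNReal.add_ne_top.2 ⟨hBfin.ne, by finiteness⟩)
  set c := c₀ * (c₁ + c₂ ^ (1 / 2 : ℝ) + 1) with hc
  have hcfin : c ≠ ∞ := by finiteness
  refine ⟨c.toNNReal, ?_⟩
  rw [ENNReal.coe_toNNReal hcfin]
  -- Chosen so that 2d(RΔ + 2) ≤ AΔ once Δ ≥ 1; the final 1 ensures AΔ ≥ 1.
  set A : ℝ := 2 * d * (R + 2) + 1 with hA
  have hA1 : 1 ≤ A := by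
    have : 0 ≤ 2 * (d : ℝ) * (R + 2) := by positivity
    linarith
  filter_upwards [hS.eventually_closedBall_subset hΔvol (A := A) (by linarith),
    hΔ.eventually_ge_atTop 1, hS.vol_tendsto.eventually_gt_atTop 0,
    -- The bias uses the oscillation at twice the diameter, hence δ₀/2; δ is the scale of the
    -- cumulant condition.
    hS.diam_tendsto.eventually (gt_mem_nhds (show (0 : ℝ) < min 1 (min (δ₀ / 2) δ) by positivity))]
    with n ⟨x₀, hball⟩ hΔ1 hvol hdiam θ hθ
  rw [lt_min_iff, lt_min_iff] at hdiam
  obtain ⟨hd1, hdδ₀, hdδ⟩ := hdiam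
  have hd0 := SpectralDensity.tessDiam_nonneg (t n)
  have hρ : 1 ≤ A * Δ n := one_le_mul_of_one_le_of_one_le hA1 hΔ1
  have hRρ : 2 * d * (R * Δ n + 2) ≤ A * Δ n := by
    calc 2 * d * (R * Δ n + 2) ≤ 2 * d * (R * Δ n + 2 * Δ n) := by gcongr; linarith
      _ = (2 * d * (R + 2)) * Δ n := by ring
      _ ≤ A * Δ n := by gcongr; linarith
  have hRρ' : 2 * d * (R * Δ n) ≤ A * Δ n :=
    (mul_le_mul_of_nonneg_left (by linarith) (by positivity)).trans hRρ
  have hbias := SpectralDensity.hsNorm_samplingBias_le hC hK hL (hS.distinct n) hΔ1 hR hρ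
    hball hRρ hvol hd1.le (hM _ (by linarith) (by linarith)) (hτ θ hθ)
  have hvar := SpectralDensity.lintegral_hsNorm_fluctuation_sq_le hX hreal hV hC hK (hS.distinct n)
    hΔ1 hR0.le hR (by linarith) hball hRρ' hvol hd1.le (hM _ hd0 (by linarith)) hdδ θ
  refine (SpectralDensity.rootMSE_le hX.memLp hC.integrable_stationaryCov hK (t n)
    (hΔpos n) θ).trans ?_
  rw [← hc₀, hc, mul_assoc]
  gcongr
  have hroot : (∫⁻ ω, SpectralDensity.hsNorm b
      (SpectralDensity.fluctuation P X K (t n) (Δ n) θ ω) ^ 2 ∂P) ^ (1 / 2 : ℝ) ≤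
      c₂ ^ (1 / 2 : ℝ) *
        ENNReal.ofReal (Real.sqrt (Δ n ^ d / SpectralDensity.regionVol (t n))) := by
    rw [Real.sqrt_eq_rpow, ← ENNReal.ofReal_rpow_of_nonneg
      (div_nonneg (pow_nonneg (hΔpos n).le d) hvol.le) (by norm_num),
      ← ENNReal.mul_rpow_of_nonneg _ _ (by norm_num)]
    gcongr
  set D := ENNReal.ofReal (SpectralDensity.tessDiam (t n) ^ γ)
  set B₁ := SpectralDensity.biasKernel b P X K (Δ n) θ
  set B₂ := SpectralDensity.biasTail b P X K (Δ n) θ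
  set s := ENNReal.ofReal (Real.sqrt (Δ n ^ d / SpectralDensity.regionVol (t n)))
  calc (∫⁻ ω, SpectralDensity.hsNorm b
        (SpectralDensity.fluctuation P X K (t n) (Δ n) θ ω) ^ 2 ∂P) ^ (1 / 2 : ℝ)
        + (SpectralDensity.hsNorm b (SpectralDensity.samplingBias P X K (t n) (Δ n) θ) + B₁ + B₂)
      ≤ c₂ ^ (1 / 2 : ℝ) * s + (c₁ * D + 1 * B₁ + 1 * B₂) := by
        rw [one_mul, one_mul]
        gcongr
    _ ≤ (c₁ + c₂ ^ (1 / 2 : ℝ) + 1) * s + ((c₁ + c₂ ^ (1 / 2 : ℝ) + 1) * D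
          + (c₁ + c₂ ^ (1 / 2 : ℝ) + 1) * B₁ + (c₁ + c₂ ^ (1 / 2 : ℝ) + 1) * B₂) := by
        gcongr
        · exact le_add_self.trans le_self_add
        · exact le_self_add.trans le_self_add
        · exact le_add_self
        · exact le_add_self
    _ = (c₁ + c₂ ^ (1 / 2 : ℝ) + 1) * (D + B₁ + B₂ + s) := by ring
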